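/- Let $q\ge1$, let $\Omega_q=\{\mathbf x\in\mathbb R^{q+1}:\|\mathbf x\|=1\}$ and let $\nu_q$ be the uniform probability distribution on $\Omega_q$. For $x\in[-1,1]$ let $$F_q(x)=\mathrm B\left(\tfrac12,\tfrac q2\right)^{-1}\int_{-1}^x(1-t^2)^{q/2-1}\,\mathrm dt,\qquad \mathrm B(a,b)=\frac{\Gamma(a)\Gamma(b)}{\Gamma(a+b)},$$ with $F_q(x)=0$ for $x<-1$ and $F_q(x)=1$ for $x>1$. For $\mathbf X,\mathbf Y\in\Omega_q$ with angle $\theta=\cos^{-1}(\mathbf X'\mathbf Y)\in[0,\pi]$ and $x\in[-1,1]$ let $$A(\theta,x)=\int_{\Omega_q}1_{\{\boldsymbol\gamma'\mathbf X\le x,\ \boldsymbol\gamma'\mathbf Y\le x\}}\,\mathrm d\nu_q(\boldsymbol\gamma).$$ Proposition. Let $0\le x\le1$ and $\theta\in[0,\pi]$, and let $\mathbf X,\mathbf Y\in\Omega_q$ be any two points with angle $\theta$. Then $A(\theta,-x)=A(\theta,x)+1-2F_q(x)$ and $$A(\theta,x)=\begin{cases}2F_1(x)-1+\frac1\pi\left(\cos^{-1}(x)-\tfrac\theta2\right)_+,&q=1,\\[1ex]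 2\displaystyle\int_{-1}^xF_{q-1}\left(\frac{t\tan(\theta/2)}{(1-t^2)^{1/2}}\right)\mathrm dF_q(t),&q\ge2,\end{cases}$$ where $(\cdot)_+$ is the positive part and where, for $\theta=\pi$, $\tan(\pi/2)$ is read as $+\infty$, that is, the integrand is $1$ for $t>0$ and $0$ for $t<0$. Alternatively, for $q\ge2$, $$A(\theta,x)=\begin{cases}\frac12-\frac\theta{2\pi}+2\displaystyle\int_0^xF_{q-1}\left(\frac{t\tan(\theta/2)}{(1-t^2)^{1/2}}\right)\mathrm dF_q(t),&0\le\theta<2\cos^{-1}(x),\\[1ex] 2F_q(x)-1,&2\cos^{-1}(x)\le\theta\le\pi,\end{cases}$$ and in this expression the argument of $F_{q-1}$ is never truncated: if $0\le\theta<2\cos^{-1}(x)$, then $\frac{t\tan(\theta/2)}{(1-t^2)^{1/2}}\in[-1,1]$ for all $t\in[0,x]$. -/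

import Mathlib

open MeasureTheory

noncomputable section

/-- The hypersphere `Ω_q`, the unit sphere of `ℝ^(q+1)`. -/
abbrev Hypersphere (q : ℕ) : Type :=
  Metric.sphere (0 : EuclideanSpace ℝ (Fin (q + 1))) 1

/-- The uniform distribution `ν_q` on `Ω_q`: the normalized surface measure. -/
def unifSphere (q : ℕ) : Measure (Hypersphere q) :=
  ((volume : Measure (EuclideanSpace ℝ (Fin (q + 1)))).toSphere Set.univ)⁻¹ •
    (volume : Measure (EuclideanSpace ℝ (Fin (q + 1)))).toSphere

/-- The integral over `γ ∈ Ω_q` of `1_{γ'X ≤ x, γ'Y ≤ x}` against `ν_q`. -/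
def capProb (q : ℕ) (X Y : Hypersphere q) (x : ℝ) : ℝ :=
  ∫ γ : Hypersphere q,
    Set.indicator
      {γ : Hypersphere q |
        inner ℝ (γ : EuclideanSpace ℝ (Fin (q + 1))) (X : EuclideanSpace ℝ (Fin (q + 1))) ≤ x ∧
        inner ℝ (γ : EuclideanSpace ℝ (Fin (q + 1))) (Y : EuclideanSpace ℝ (Fin (q + 1))) ≤ x}
      (fun _ => (1 : ℝ)) γ
    ∂(unifSphere q)

/-- The probability density `B(1/2, q/2)⁻¹ (1 - t²)^(q/2 - 1)` (to be used on `[-1, 1]` only). -/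
def projDensity (q : ℕ) (t : ℝ) : ℝ :=
  (ProbabilityTheory.beta (1 / 2) ((q : ℝ) / 2))⁻¹ * (1 - t ^ 2) ^ ((q : ℝ) / 2 - 1)

/-- The cumulative distribution function `F_q` on the whole real line: for `x ∈ [-1, 1]` it is
`B(1/2, q/2)⁻¹ ∫_{-1}^x (1 - t²)^(q/2 - 1) dt`; it is `0` below `-1` and constant above `1`
(the argument is truncated to `[-1, 1]`). -/
def projCdf (q : ℕ) (x : ℝ) : ℝ :=
  ∫ t in (-1 : ℝ)..(max (-1) (min x 1)), projDensity q t

/-- The measure `dF_q` on `ℝ`: the density `projDensity q` on `[-1, 1]`. -/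
def projMeasure (q : ℕ) : Measure ℝ :=
  (volume.restrict (Set.Icc (-1 : ℝ) 1)).withDensity (fun t => ENNReal.ofReal (projDensity q t))

lemma projDensity_nonneg {q : ℕ} (hq : 1 ≤ q) {t : ℝ} (ht : t ∈ Set.Icc (-1 : ℝ) 1) :
    0 ≤ projDensity q t := by
  have hq' : (0 : ℝ) < q := by exact_mod_cast hq
  have hb := ProbabilityTheory.beta_pos (α := 1 / 2) (β := (q : ℝ) / 2) (by norm_num) (by linarith)
  have : 0 ≤ 1 - t ^ 2 := by nlinarith [ht.1, ht.2]
  unfold projDensity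
  positivity

lemma projDensity_integrableOn {q : ℕ} (hq : 1 ≤ q) :
    IntegrableOn (projDensity q) (Set.Ioc (-1 : ℝ) 1) := by
  refine Integrable.const_mul ?_ _
  rcases Nat.lt_or_ge 1 q with h | h
  · have h2 : (2 : ℝ) ≤ q := by exact_mod_cast h
    have hc : Continuous fun t : ℝ => (1 - t ^ 2) ^ ((q : ℝ) / 2 - 1) :=
      (by fun_prop : Continuous fun t : ℝ => 1 - t ^ 2).rpow_const
        (fun _ => Or.inr (by linarith))
    exact hc.integrableOn_Ioc
  · obtain rfl : q = 1 := le_antisymm h hq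
    have key : IntegrableOn (fun t : ℝ => 1 / Real.sqrt (1 - t ^ 2)) (Set.Ioc (-1 : ℝ) 1) :=
      intervalIntegral.integrableOn_deriv_of_nonneg (g := Real.arcsin)
        Real.continuous_arcsin.continuousOn
        (fun t ht => Real.hasDerivAt_arcsin (by linarith [ht.1]) (by linarith [ht.2]))
        (fun t _ => by positivity)
    refine key.congr_fun (fun t ht => ?_) measurableSet_Ioc
    have h0 : 0 ≤ 1 - t ^ 2 := by nlinarith [ht.1, ht.2]
    have he : ((1 : ℕ) : ℝ) / 2 - 1 = -(1 / 2) := by norm_num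
    simp only [he, Real.rpow_neg h0, Real.sqrt_eq_rpow, one_div]

/-- `projMeasure q` is the Lebesgue-Stieltjes measure of `projCdf q`. -/
lemma projMeasure_Iic {q : ℕ} (hq : 1 ≤ q) (x : ℝ) :
    projMeasure q (Set.Iic x) = ENNReal.ofReal (projCdf q x) := by
  have hle : (-1 : ℝ) ≤ max (-1) (min x 1) := le_max_left _ _
  have hm1 : max (-1) (min x 1) ≤ 1 := max_le (by norm_num) (min_le_right _ _)
  unfold projCdf projMeasure
  rw [intervalIntegral.integral_of_le hle, withDensity_apply _ measurableSet_Iic,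
    Measure.restrict_congr_set Ioc_ae_eq_Icc.symm, Measure.restrict_restrict measurableSet_Iic,
    ofReal_integral_eq_lintegral_ofReal]
  · congr 2
    ext t
    simp only [Set.mem_inter_iff, Set.mem_Iic, Set.mem_Ioc, le_max_iff, le_min_iff]
    constructor
    · rintro ⟨h1, h2, h3⟩
      exact ⟨h2, Or.inr ⟨h1, h3⟩⟩
    · rintro ⟨h2, h | h⟩
      · linarith
      · exact ⟨h.1, h2, h.2⟩
  · exact (projDensity_integrableOn hq).mono_set (Set.Ioc_subset_Ioc_right hm1)
  · exact (ae_restrict_iff' measurableSet_Ioc).2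
      (Filter.Eventually.of_forall fun t ht =>
        projDensity_nonneg hq ⟨ht.1.le, ht.2.trans hm1⟩)

end

/-! Slice the sphere by the coordinate `t = γ'X`: `t` has law `dF_q`, and given `t` the point is `t
X + √(1 - t²) ξ` with `ξ` uniform on a sphere of one dimension less. `lintegral_unifSphere_slice`
proves this and `unifSphere_isometry` supplies rotation invariance; both come from Lebesgue measure
through polar coordinates.

For `X ≠ Y`, the region `γ'X ≤ x, γ'Y ≤ x` splits, up to a null set, into two mirror images
according to which inner product is larger, so `A` is twice the mass of `γ'X ≤ x, γ'Y ≤ γ'X`. On a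
slice the second condition reads `ξ'Z ≤ t tan(θ/2) / √(1 - t²)`, where `Z` is the direction of the
part of `Y` orthogonal to `X`. This is the integral formula (`capProb_eq_integral_Iic`).

If `2 arccos x ≤ θ`, the complementary caps are disjoint and inclusion-exclusion gives `2 F_q(x) -
1` (`capProb_of_disjoint`). Otherwise the integral is split at `0`; the part below `0` is the
two-hemisphere probability `1/2 - θ/(2π)`, which does not depend on the dimension and is reduced to
the circle (`capProb_zero`). On the circle the slices are two-point spheres, the integrand is
constantly `1/2` on `[0, cos(θ/2))`, and the value is propagated down from `x = cos(θ/2)`, where the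
caps are just disjoint (`capProb_circle`). -/

noncomputable section

/-! ### Polar coordinates and the surface measure -/

section Polar

variable {E : Type*} [NormedAddCommGroup E] [NormedSpace ℝ E] [MeasurableSpace E] [BorelSpace E]
  [FiniteDimensional ℝ E] [Nontrivial E] (μ : Measure E) [μ.IsAddHaarMeasure]

/-- Integration in polar coordinates. -/
lemma lintegral_eq_lintegral_toSphere {F : E → ENNReal} (hF : Measurable F) :
    ∫⁻ x, F x ∂μ = ∫⁻ γ, (∫⁻ r in Set.Ioi (0 : ℝ),
      ENNReal.ofReal (r ^ (Module.finrank ℝ E - 1)) * F (r • (γ : E))) ∂μ.toSphere := by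
  have hmeas : Measurable fun p : Metric.sphere (0 : E) 1 × Set.Ioi (0 : ℝ) =>
      F ((p.2 : ℝ) • (p.1 : E)) := by fun_prop
  calc ∫⁻ x, F x ∂μ = ∫⁻ x in ({0}ᶜ : Set E), F x ∂μ := by
        rw [restrict_compl_singleton]
    _ = ∫⁻ x : ({0}ᶜ : Set E), F x ∂(μ.comap (↑)) := by
        rw [lintegral_subtype_comap (measurableSet_singleton _).compl]
    _ = ∫⁻ p, F ((p.2 : ℝ) • (p.1 : E))
          ∂(μ.toSphere.prod (Measure.volumeIoiPow (Module.finrank ℝ E - 1))) := by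
        rw [← μ.measurePreserving_homeomorphUnitSphereProd.lintegral_comp hmeas]
        refine lintegral_congr fun x => ?_
        have hx : ‖(x : E)‖ ≠ 0 := norm_ne_zero_iff.2 x.2
        simp [smul_smul, hx]
    _ = _ := by
        rw [lintegral_prod _ hmeas.aemeasurable]
        refine lintegral_congr fun γ => ?_
        rw [Measure.volumeIoiPow, lintegral_withDensity_eq_lintegral_mul _ (by fun_prop)
          (by fun_prop)]
        exact lintegral_subtype_comap measurableSet_Ioi
          (fun r : ℝ => ENNReal.ofReal (r ^ (Module.finrank ℝ E - 1)) * F (r • (γ : E)))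

/-- The integral of `r ^ n` over `(0, 1)`. -/
def radialMass (n : ℕ) : ENNReal :=
  ∫⁻ r in Set.Ioi (0 : ℝ), ENNReal.ofReal (r ^ n) * (Set.Iio (1 : ℝ)).indicator 1 r

lemma radialMass_ne_top (n : ℕ) : radialMass n ≠ ⊤ := by
  refine ne_top_of_le_ne_top (b := volume (Set.Ioo (0 : ℝ) 1)) (by simp) ?_
  rw [← lintegral_indicator_one measurableSet_Ioo, radialMass,
    ← lintegral_indicator measurableSet_Ioi]
  refine lintegral_mono fun r => ?_
  by_cases h0 : 0 < r <;> by_cases h1 : r < 1 <;> simp [h0, h1]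
  exact pow_le_one₀ h0.le h1.le

lemma radialMass_ne_zero (n : ℕ) : radialMass n ≠ 0 := by
  intro h
  rw [radialMass, lintegral_eq_zero_iff (by fun_prop (disch := measurability))] at h
  have h2 : volume.restrict (Set.Ioi (0 : ℝ)) (Set.Ioo 0 1) = 0 := by
    refine measure_mono_null (fun r hr => ?_) (ae_iff.1 h)
    simp [hr.2, pow_pos hr.1]
  rw [Measure.restrict_apply measurableSet_Ioo, Set.inter_eq_left.2 fun r hr => hr.1] at h2
  simp at h2

/-- Extending `f` from the sphere to the ball by degree-0 homogeneity turns surface integrals into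
volume integrals. Since the radial factor is finite and nonzero it can be cancelled, so facts about
Lebesgue measure descend to the sphere. -/
lemma lintegral_radial {f : E → ENNReal} (hf : Measurable f) :
    ∫⁻ x, f (‖x‖⁻¹ • x) * (Set.Iio (1 : ℝ)).indicator 1 ‖x‖ ∂μ =
      radialMass (Module.finrank ℝ E - 1) * ∫⁻ γ, f (γ : E) ∂μ.toSphere := by
  have hi : Measurable fun r : ℝ => (Set.Iio (1 : ℝ)).indicator (1 : ℝ → ENNReal) r :=
    measurable_one.indicator measurableSet_Iio
  rw [lintegral_eq_lintegral_toSphere μ (by fun_prop),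
    ← lintegral_const_mul _ (by fun_prop)]
  refine lintegral_congr fun γ => ?_
  rw [radialMass, ← lintegral_mul_const _ (by fun_prop)]
  refine setLIntegral_congr_fun measurableSet_Ioi fun r hr => ?_
  have hr : 0 < r := hr
  have hγ : ‖(γ : E)‖ = 1 := by simp
  simp only [norm_smul, hγ, Real.norm_eq_abs, abs_of_pos hr, mul_one, smul_smul,
    inv_mul_cancel₀ hr.ne', one_smul]
  ring

end Polar

/-! ### Slicing the surface measure by one coordinate -/

/-- The half-plane in coordinates `(ρ t, ρ √(1 - t²))`. -/
lemma lintegral_halfPlane {k : ℝ × ℝ → ENNReal} (hk : Measurable k) :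
    ∫⁻ s, ∫⁻ r in Set.Ioi (0 : ℝ), k (s, r) =
      ∫⁻ t in Set.Ioo (-1 : ℝ) 1, ENNReal.ofReal (√(1 - t ^ 2))⁻¹ *
        ∫⁻ ρ in Set.Ioi (0 : ℝ), ENNReal.ofReal ρ * k (ρ * t, ρ * √(1 - t ^ 2)) := by
  set k' : ℝ × ℝ → ENNReal := (Set.univ ×ˢ Set.Ioi (0 : ℝ)).indicator k with hk'
  have hk'm : Measurable k' := hk.indicator (MeasurableSet.univ.prod measurableSet_Ioi)
  have h1 : ∫⁻ s, ∫⁻ r in Set.Ioi (0 : ℝ), k (s, r) = ∫⁻ p, k' p := by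
    rw [Measure.volume_eq_prod, lintegral_prod _ hk'm.aemeasurable]
    refine lintegral_congr fun s => ?_
    rw [← lintegral_indicator measurableSet_Ioi]
    refine lintegral_congr fun r => ?_
    simp [k', Set.indicator]
  have h2 : ∫⁻ p, k' p = ∫⁻ φ in Set.Ioo 0 Real.pi, ∫⁻ ρ in Set.Ioi (0 : ℝ),
      ENNReal.ofReal ρ * k (ρ * Real.cos φ, ρ * Real.sin φ) := by
    rw [← lintegral_comp_polarCoord_symm, polarCoord_target, Measure.volume_eq_prod,
      ← Measure.prod_restrict, lintegral_prod_symm']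
    · rw [← lintegral_indicator measurableSet_Ioo, ← lintegral_indicator measurableSet_Ioo]
      refine lintegral_congr fun φ => ?_
      by_cases hφ : φ ∈ Set.Ioo 0 Real.pi
      · rw [Set.indicator_of_mem hφ, Set.indicator_of_mem
          (show φ ∈ Set.Ioo (-Real.pi) Real.pi from ⟨by linarith [hφ.1, Real.pi_pos], hφ.2⟩)]
        refine setLIntegral_congr_fun measurableSet_Ioi fun ρ hρ => ?_
        have := mul_pos (Set.mem_Ioi.1 hρ) (Real.sin_pos_of_pos_of_lt_pi hφ.1 hφ.2)
        simp [k', this]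
      -- Angles in `(-π, 0]` give points outside the open upper half-plane and contribute nothing.
      · rw [Set.indicator_of_notMem hφ]
        refine Set.indicator_apply_eq_zero.2 fun hφ' => ?_
        rw [setLIntegral_congr_fun (g := fun _ => 0) measurableSet_Ioi, lintegral_zero]
        intro ρ hρ
        have hs : Real.sin φ ≤ 0 := by
          refine Real.sin_nonpos_of_nonpos_of_neg_pi_le ?_ hφ'.1.le
          by_contra h
          exact hφ ⟨not_le.1 h, hφ'.2⟩
        have := mul_nonpos_of_nonneg_of_nonpos (Set.mem_Ioi.1 hρ).le hs
        simp [k', not_lt.2 this]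
    · have := continuous_polarCoord_symm.measurable
      fun_prop
  have h3 : Real.cos '' Set.Ioo 0 Real.pi = Set.Ioo (-1) 1 := by
    apply Set.Subset.antisymm
    · rintro _ ⟨φ, hφ, rfl⟩
      constructor
      · rw [← Real.cos_pi]
        exact Real.cos_lt_cos_of_nonneg_of_le_pi hφ.1.le le_rfl hφ.2
      · rw [← Real.cos_zero]
        exact Real.cos_lt_cos_of_nonneg_of_le_pi le_rfl hφ.2.le hφ.1
    · intro t ht
      refine ⟨Real.arccos t, ⟨Real.arccos_pos.2 ht.2, ?_⟩, Real.cos_arccos ht.1.le ht.2.le⟩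
      refine lt_of_le_of_ne (Real.arccos_le_pi t) fun h => ?_
      linarith [Real.arccos_eq_pi.1 h, ht.1]
  -- Substitute `t = cos φ`; the Jacobian `sin φ` cancels the weight `1 / √(1 - t²)`.
  rw [h1, h2, ← h3, lintegral_image_eq_lintegral_abs_deriv_mul measurableSet_Ioo
    (fun φ _ => (Real.hasDerivAt_cos φ).hasDerivWithinAt)
    (Real.injOn_cos.mono Set.Ioo_subset_Icc_self)]
  refine setLIntegral_congr_fun measurableSet_Ioo fun φ hφ => ?_
  have hs : 0 < Real.sin φ := Real.sin_pos_of_pos_of_lt_pi hφ.1 hφ.2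
  have hsq : √(1 - Real.cos φ ^ 2) = Real.sin φ := by
    rw [← Real.sin_sq, Real.sqrt_sq hs.le]
  simp only [hsq, abs_neg, abs_of_pos hs]
  rw [← mul_assoc, ← ENNReal.ofReal_mul hs.le, mul_inv_cancel₀ hs.ne']
  simp

/-- The vector with first coordinate `t` and remaining coordinates `y`. -/
def EuclideanSpace.cons {n : ℕ} (t : ℝ) (y : EuclideanSpace ℝ (Fin n)) :
    EuclideanSpace ℝ (Fin (n + 1)) :=
  WithLp.toLp 2 (Fin.cons t y.ofLp)

namespace EuclideanSpace

variable {n : ℕ}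

@[simp] lemma cons_zero (t : ℝ) (y : EuclideanSpace ℝ (Fin n)) : cons t y 0 = t := rfl

@[simp] lemma cons_succ (t : ℝ) (y : EuclideanSpace ℝ (Fin n)) (i : Fin n) :
    cons t y i.succ = y i := rfl

lemma smul_cons (r t : ℝ) (y : EuclideanSpace ℝ (Fin n)) :
    r • cons t y = cons (r * t) (r • y) := by
  ext i
  refine Fin.cases ?_ (fun j => ?_) i <;> simp

lemma inner_cons (s t : ℝ) (y z : EuclideanSpace ℝ (Fin n)) :
    inner ℝ (cons s y) (cons t z) = s * t + inner ℝ y z := by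
  simp [PiLp.inner_apply, Fin.sum_univ_succ, mul_comm]

lemma norm_cons_sq (t : ℝ) (y : EuclideanSpace ℝ (Fin n)) :
    ‖cons t y‖ ^ 2 = t ^ 2 + ‖y‖ ^ 2 := by
  rw [← real_inner_self_eq_norm_sq, inner_cons, real_inner_self_eq_norm_sq, sq t]

@[fun_prop]
lemma measurable_cons : Measurable fun p : ℝ × EuclideanSpace ℝ (Fin n) => cons p.1 p.2 := by
  refine (WithLp.measurable_toLp 2 _).comp (measurable_pi_iff.2 fun i => ?_)
  refine Fin.cases ?_ (fun j => ?_) i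
  · exact measurable_fst
  · exact (measurable_pi_apply j).comp ((WithLp.measurable_ofLp 2 _).comp measurable_snd)

lemma measurePreserving_cons :
    MeasurePreserving (fun p : ℝ × EuclideanSpace ℝ (Fin n) => cons p.1 p.2) := by
  have h1 := (volume_preserving_piFinSuccAbove (fun _ : Fin (n + 1) => ℝ) 0).symm
  have h2 := (MeasurePreserving.id (volume : Measure ℝ)).prod (PiLp.volume_preserving_ofLp (Fin n))
  have h3 := (PiLp.volume_preserving_toLp (Fin (n + 1))).comp (h1.comp h2)
  have h4 : (fun p : ℝ × EuclideanSpace ℝ (Fin n) => cons p.1 p.2) =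
      WithLp.toLp 2 ∘ (MeasurableEquiv.piFinSuccAbove (fun _ => ℝ) 0).symm ∘
        Prod.map id WithLp.ofLp := by
    ext p i
    simp [cons, MeasurableEquiv.piFinSuccAbove]
  rw [h4]
  exact h3

end EuclideanSpace

/-- Polar coordinates in `ℝ ^ (m + 1)`. -/
lemma EuclideanSpace.lintegral_eq_lintegral_toSphere (m : ℕ)
    {G : EuclideanSpace ℝ (Fin (m + 1)) → ENNReal} (hG : Measurable G) :
    ∫⁻ x, G x = ∫⁻ ξ : Hypersphere m, (∫⁻ r in Set.Ioi (0 : ℝ),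
      ENNReal.ofReal (r ^ m) * G (r • (ξ : EuclideanSpace ℝ (Fin (m + 1)))))
        ∂(volume : Measure (EuclideanSpace ℝ (Fin (m + 1)))).toSphere := by
  have := _root_.lintegral_eq_lintegral_toSphere volume hG
  rwa [finrank_euclideanSpace_fin] at this

open EuclideanSpace in
/-- Slicing the surface measure by the first coordinate. -/
lemma lintegral_toSphere_slice (m : ℕ) {f : EuclideanSpace ℝ (Fin (m + 1 + 1)) → ENNReal}
    (hf : Measurable f) :
    ∫⁻ γ : Hypersphere (m + 1), f γ
        ∂(volume : Measure (EuclideanSpace ℝ (Fin (m + 1 + 1)))).toSphere =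
      ∫⁻ t in Set.Ioo (-1 : ℝ) 1,
        ENNReal.ofReal ((1 - t ^ 2) ^ (((m + 1 : ℕ) : ℝ) / 2 - 1)) *
          ∫⁻ ξ : Hypersphere m, f (cons t (√(1 - t ^ 2) • (ξ : EuclideanSpace ℝ (Fin (m + 1)))))
            ∂(volume : Measure (EuclideanSpace ℝ (Fin (m + 1)))).toSphere := by
  have hi : Measurable fun r : ℝ => (Set.Iio (1 : ℝ)).indicator (1 : ℝ → ENNReal) r :=
    measurable_one.indicator measurableSet_Iio
  -- `F` is the degree-0 extension of `f`, cut off to the open unit ball. Its integral is computed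
  -- in two ways, each producing the factor `radialMass (m + 1)`, which cancels at the end.
  obtain ⟨F, hF⟩ : ∃ F : EuclideanSpace ℝ (Fin (m + 1 + 1)) → ENNReal,
      F = fun x => f (‖x‖⁻¹ • x) * (Set.Iio (1 : ℝ)).indicator 1 ‖x‖ := ⟨_, rfl⟩
  have hFm : Measurable F := by
    rw [hF]
    fun_prop
  have hL : ∫⁻ x, F x = radialMass (m + 1) * ∫⁻ γ : Hypersphere (m + 1), f γ
      ∂(volume : Measure (EuclideanSpace ℝ (Fin (m + 1 + 1)))).toSphere := by
    have := lintegral_radial (volume : Measure (EuclideanSpace ℝ (Fin (m + 1 + 1)))) hf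
    rwa [finrank_euclideanSpace_fin, ← hF] at this
  have hcm : Measurable fun p : ℝ × Hypersphere m =>
      f (cons p.1 (√(1 - p.1 ^ 2) • (p.2 : EuclideanSpace ℝ (Fin (m + 1))))) :=
    hf.comp (measurable_cons.comp (g := fun p : ℝ × EuclideanSpace ℝ (Fin (m + 1)) =>
      cons p.1 p.2) (f := fun p : ℝ × Hypersphere m =>
        (p.1, √(1 - p.1 ^ 2) • (p.2 : EuclideanSpace ℝ (Fin (m + 1))))) (by fun_prop))
  have hR : ∫⁻ x, F x = radialMass (m + 1) * ∫⁻ t in Set.Ioo (-1 : ℝ) 1,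
        ENNReal.ofReal ((1 - t ^ 2) ^ (((m + 1 : ℕ) : ℝ) / 2 - 1)) *
          ∫⁻ ξ : Hypersphere m, f (cons t (√(1 - t ^ 2) • (ξ : EuclideanSpace ℝ (Fin (m + 1)))))
            ∂(volume : Measure (EuclideanSpace ℝ (Fin (m + 1)))).toSphere := by
    have hGm : Measurable fun p : ℝ × EuclideanSpace ℝ (Fin (m + 1)) => F (cons p.1 p.2) :=
      hFm.comp measurable_cons
    have hkm (ξ : Hypersphere m) : Measurable fun p : ℝ × ℝ => ENNReal.ofReal (p.2 ^ m) *
        F (cons p.1 (p.2 • (ξ : EuclideanSpace ℝ (Fin (m + 1))))) := by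
      refine Measurable.mul (by fun_prop) ?_
      exact hGm.comp (f := fun p : ℝ × ℝ =>
        (p.1, p.2 • (ξ : EuclideanSpace ℝ (Fin (m + 1))))) (by fun_prop)
    calc ∫⁻ x, F x = ∫⁻ p : ℝ × EuclideanSpace ℝ (Fin (m + 1)), F (cons p.1 p.2) :=
          (measurePreserving_cons.lintegral_comp hFm).symm
      _ = ∫⁻ s, ∫⁻ y : EuclideanSpace ℝ (Fin (m + 1)), F (cons s y) := by
          rw [Measure.volume_eq_prod, lintegral_prod _ hGm.aemeasurable]
      _ = ∫⁻ s, ∫⁻ ξ : Hypersphere m, (∫⁻ r in Set.Ioi (0 : ℝ), ENNReal.ofReal (r ^ m) *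
            F (cons s (r • (ξ : EuclideanSpace ℝ (Fin (m + 1))))))
            ∂(volume : Measure (EuclideanSpace ℝ (Fin (m + 1)))).toSphere := by
          refine lintegral_congr fun s => ?_
          have h : Measurable fun y : EuclideanSpace ℝ (Fin (m + 1)) => F (cons s y) :=
            hGm.comp (measurable_prodMk_left (x := s))
          exact EuclideanSpace.lintegral_eq_lintegral_toSphere m h
      _ = ∫⁻ ξ : Hypersphere m, (∫⁻ s, ∫⁻ r in Set.Ioi (0 : ℝ), ENNReal.ofReal (r ^ m) *
            F (cons s (r • (ξ : EuclideanSpace ℝ (Fin (m + 1))))))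
            ∂(volume : Measure (EuclideanSpace ℝ (Fin (m + 1)))).toSphere := by
          rw [lintegral_lintegral_swap]
          refine Measurable.aemeasurable ?_
          refine Measurable.lintegral_prod_right'
            (f := fun z : (ℝ × Hypersphere m) × ℝ => ENNReal.ofReal (z.2 ^ m) *
              F (cons z.1.1 (z.2 • (z.1.2 : EuclideanSpace ℝ (Fin (m + 1)))))) ?_
          refine Measurable.mul (by fun_prop) ?_
          exact hGm.comp (f := fun z : (ℝ × Hypersphere m) × ℝ =>
            (z.1.1, z.2 • (z.1.2 : EuclideanSpace ℝ (Fin (m + 1))))) (by fun_prop)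
      _ = ∫⁻ ξ : Hypersphere m, (∫⁻ t in Set.Ioo (-1 : ℝ) 1,
            radialMass (m + 1) * (ENNReal.ofReal ((1 - t ^ 2) ^ (((m + 1 : ℕ) : ℝ) / 2 - 1)) *
              f (cons t (√(1 - t ^ 2) • (ξ : EuclideanSpace ℝ (Fin (m + 1)))))))
            ∂(volume : Measure (EuclideanSpace ℝ (Fin (m + 1)))).toSphere := by
          refine lintegral_congr fun ξ => ?_
          rw [lintegral_halfPlane (hkm ξ)]
          refine setLIntegral_congr_fun measurableSet_Ioo fun t ht => ?_
          have hpos : 0 < 1 - t ^ 2 := by nlinarith [ht.1, ht.2]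
          set w := √(1 - t ^ 2) with hw
          have hw0 : 0 < w := Real.sqrt_pos.2 hpos
          have hw2 : w ^ 2 = 1 - t ^ 2 := Real.sq_sqrt hpos.le
          -- The factor `w⁻¹` is the half-plane weight; `w ^ m` comes from `r ^ m` with `r = ρ w`.
          -- The remaining `ρ * ρ ^ m` yields `radialMass (m + 1)`.
          have hpow : (1 - t ^ 2) ^ (((m + 1 : ℕ) : ℝ) / 2 - 1) = w⁻¹ * w ^ m := by
            rw [← hw2, ← Real.rpow_natCast w 2, ← Real.rpow_mul hw0.le, ← Real.rpow_natCast w m,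
              ← Real.rpow_neg_one, ← Real.rpow_add hw0]
            congr 1
            push_cast
            ring
          have hξ : ‖(ξ : EuclideanSpace ℝ (Fin (m + 1)))‖ = 1 := by simp
          have hn : ‖cons t (w • (ξ : EuclideanSpace ℝ (Fin (m + 1))))‖ = 1 := by
            have := norm_cons_sq t (w • (ξ : EuclideanSpace ℝ (Fin (m + 1))))
            rw [norm_smul, hξ, mul_one, Real.norm_eq_abs, sq_abs, hw2] at this
            have h1 : ‖cons t (w • (ξ : EuclideanSpace ℝ (Fin (m + 1))))‖ ^ 2 = 1 := by linarith
            exact (pow_eq_one_iff_of_nonneg (norm_nonneg _) two_ne_zero).1 h1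
          rw [hpow, ENNReal.ofReal_mul (by positivity), radialMass,
            ← lintegral_mul_const _ (by fun_prop),
            ← lintegral_const_mul _ (by
              refine Measurable.mul (by fun_prop) ?_
              exact (hkm ξ).comp (f := fun ρ : ℝ => (ρ * t, ρ * w)) (by fun_prop))]
          refine setLIntegral_congr_fun measurableSet_Ioi fun ρ hρ => ?_
          have hρ : 0 < ρ := hρ
          have hs : cons (ρ * t) ((ρ * w) • (ξ : EuclideanSpace ℝ (Fin (m + 1)))) =
              ρ • cons t (w • (ξ : EuclideanSpace ℝ (Fin (m + 1)))) := by
            rw [smul_cons, smul_smul]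
          simp only [hF, hs, norm_smul, hn, Real.norm_eq_abs, abs_of_pos hρ, mul_one, smul_smul,
            inv_mul_cancel₀ hρ.ne', one_smul]
          rw [mul_pow, pow_succ, ENNReal.ofReal_mul (by positivity),
            ENNReal.ofReal_mul (by positivity)]
          ring
      _ = _ := by
          rw [lintegral_lintegral_swap, ← lintegral_const_mul]
          · refine lintegral_congr fun t => ?_
            have : Measurable fun ξ : Hypersphere m =>
                f (cons t (√(1 - t ^ 2) • (ξ : EuclideanSpace ℝ (Fin (m + 1))))) :=
              hcm.comp (measurable_prodMk_left (x := t))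
            exact (lintegral_const_mul _ (this.const_mul _)).trans
              (congrArg _ (lintegral_const_mul _ this))
          · refine Measurable.mul (by fun_prop) ?_
            exact Measurable.lintegral_prod_right hcm
          · refine Measurable.aemeasurable ?_
            refine Measurable.const_mul (Measurable.mul (by fun_prop) ?_) _
            exact hcm.comp measurable_swap
  rw [hL] at hR
  exact (ENNReal.mul_right_inj (radialMass_ne_zero _) (radialMass_ne_top _)).1 hR

/-- With `u = (1 + t) / 2` one has `1 - t² = 4u(1 - u)`, so the integral is `2 ^ (2a - 1) B(a, a)`
for `a = q / 2`; Legendre's duplication formula identifies this with `B(1/2, a)`. -/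
lemma lintegral_one_sub_sq_rpow {q : ℕ} (hq : 1 ≤ q) :
    ∫⁻ t in Set.Ioo (-1 : ℝ) 1, ENNReal.ofReal ((1 - t ^ 2) ^ ((q : ℝ) / 2 - 1)) =
      ENNReal.ofReal (ProbabilityTheory.beta (1 / 2) ((q : ℝ) / 2)) := by
  have hq' : (0 : ℝ) < (q : ℝ) / 2 := by positivity
  set a : ℝ := (q : ℝ) / 2 with ha
  have hb := ProbabilityTheory.beta_pos hq' hq'
  have hdup : ProbabilityTheory.beta (1 / 2) a =
      2 ^ (2 * a - 1) * ProbabilityTheory.beta a a := by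
    have h := Real.Gamma_mul_Gamma_add_half a
    have h1 := (Real.Gamma_pos_of_pos hq').ne'
    have h2 := (Real.Gamma_pos_of_pos (show 0 < a + 1 / 2 by linarith)).ne'
    have h3 := (Real.Gamma_pos_of_pos (show 0 < 2 * a by linarith)).ne'
    have h4 : (2 : ℝ) ^ (1 - 2 * a) * 2 ^ (2 * a - 1) = 1 := by
      rw [← Real.rpow_add two_pos]
      simp
    unfold ProbabilityTheory.beta
    rw [Real.Gamma_one_half_eq, add_comm (1 / 2) a, ← two_mul a, mul_div_assoc', div_eq_div_iff h2 h3]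
    linear_combination (-(2 : ℝ) ^ (2 * a - 1) * Real.Gamma a) * h -
      Real.Gamma a * Real.Gamma (2 * a) * √Real.pi * h4
  have hone : ∫⁻ u in Set.Ioo (0 : ℝ) 1, ENNReal.ofReal
      (1 / ProbabilityTheory.beta a a * u ^ (a - 1) * (1 - u) ^ (a - 1)) = 1 := by
    rw [← ProbabilityTheory.lintegral_betaPDF, ProbabilityTheory.lintegral_betaPDF_eq_one hq' hq']
  have himg : (fun t : ℝ => (1 + t) / 2) '' Set.Ioo (-1) 1 = Set.Ioo 0 1 := by
    ext u
    constructor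
    · rintro ⟨t, ht, rfl⟩
      constructor <;> simp only <;> linarith [ht.1, ht.2]
    · intro hu
      exact ⟨2 * u - 1, ⟨by linarith [hu.1], by linarith [hu.2]⟩, by ring⟩
  rw [← himg, lintegral_image_eq_lintegral_abs_deriv_mul measurableSet_Ioo
    (f := fun t : ℝ => (1 + t) / 2) (f' := fun _ => 1 / 2)
    (fun t _ => (((hasDerivAt_id t).const_add 1).div_const 2).hasDerivWithinAt)
    (fun s _ t _ h => by simp only at h; linarith)] at hone
  rw [← mul_one (ENNReal.ofReal (ProbabilityTheory.beta (1 / 2) a)), ← hone,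
    ← lintegral_const_mul' _ _ ENNReal.ofReal_ne_top]
  refine setLIntegral_congr_fun measurableSet_Ioo fun t ht => ?_
  have h1 : 0 < 1 + t := by linarith [ht.1]
  have h2 : 0 < 1 - t := by linarith [ht.2]
  rw [← ENNReal.ofReal_mul (by positivity), ← ENNReal.ofReal_mul (by rw [hdup]; positivity), hdup]
  congr 1
  have e1 : 1 - t ^ 2 = 4 * (((1 + t) / 2) * (1 - (1 + t) / 2)) := by ring
  have h3 : 0 < 1 - (1 + t) / 2 := by linarith
  have h4 : (4 : ℝ) ^ (a - 1) * 2 = 2 ^ (2 * a - 1) := by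
    rw [show (4 : ℝ) = 2 ^ (2 : ℝ) by norm_num, ← Real.rpow_mul two_pos.le]
    conv_lhs => rw [← Real.rpow_one 2, ← Real.rpow_mul two_pos.le]
    rw [one_mul, ← Real.rpow_add two_pos]
    congr 1
    ring
  rw [e1, Real.mul_rpow (by norm_num) (by positivity), Real.mul_rpow (by positivity) h3.le, ← h4,
    abs_of_pos (by norm_num)]
  field_simp

/-! ### The uniform distribution: slices, rotations and projections -/

open EuclideanSpace

instance (q : ℕ) : IsProbabilityMeasure (unifSphere q) := by
  constructor
  rw [unifSphere, Measure.smul_apply, smul_eq_mul]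
  exact ENNReal.inv_mul_cancel (Measure.measure_univ_ne_zero.2 (Measure.toSphere_ne_zero _))
    (measure_ne_top _ _)

lemma lintegral_projMeasure (q : ℕ) {g : ℝ → ENNReal} (hg : Measurable g) :
    ∫⁻ t, g t ∂(projMeasure q) =
      ∫⁻ t in Set.Ioo (-1 : ℝ) 1, ENNReal.ofReal (projDensity q t) * g t := by
  have hd : Measurable (projDensity q) := by unfold projDensity; fun_prop
  rw [projMeasure, lintegral_withDensity_eq_lintegral_mul _ hd.ennreal_ofReal hg,
    ← Measure.restrict_congr_set Ioo_ae_eq_Icc]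
  rfl

lemma ae_projMeasure_mem_Ioo (q : ℕ) : ∀ᵐ t ∂(projMeasure q), t ∈ Set.Ioo (-1 : ℝ) 1 := by
  rw [projMeasure, ← Measure.restrict_congr_set Ioo_ae_eq_Icc]
  exact (withDensity_absolutelyContinuous _ _).ae_le (ae_restrict_mem measurableSet_Ioo)

instance (q : ℕ) : NullSingletonClass (projMeasure q) := by
  unfold projMeasure
  infer_instance

/-- The normalizing constant of `dF_q` is exactly the ratio of consecutive surface areas, which is
why normalized slices carry no extra constant. -/
lemma toSphere_univ_slice (m : ℕ) :
    (volume : Measure (EuclideanSpace ℝ (Fin (m + 1 + 1)))).toSphere Set.univ =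
      ENNReal.ofReal (ProbabilityTheory.beta (1 / 2) (((m + 1 : ℕ) : ℝ) / 2)) *
        (volume : Measure (EuclideanSpace ℝ (Fin (m + 1)))).toSphere Set.univ := by
  have h := lintegral_toSphere_slice m (f := fun _ => 1) measurable_const
  simp only [lintegral_one] at h
  rw [h, lintegral_mul_const _ (by fun_prop), lintegral_one_sub_sq_rpow (by omega)]

/-- Slicing the uniform distribution on the sphere by the first coordinate. -/
lemma lintegral_unifSphere_slice (m : ℕ) {f : EuclideanSpace ℝ (Fin (m + 1 + 1)) → ENNReal}
    (hf : Measurable f) :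
    ∫⁻ γ : Hypersphere (m + 1), f γ ∂(unifSphere (m + 1)) =
      ∫⁻ t, (∫⁻ ξ : Hypersphere m,
        f (cons t (√(1 - t ^ 2) • (ξ : EuclideanSpace ℝ (Fin (m + 1)))))
          ∂(unifSphere m)) ∂(projMeasure (m + 1)) := by
  have hb : 0 < ProbabilityTheory.beta (1 / 2) (((m + 1 : ℕ) : ℝ) / 2) :=
    ProbabilityTheory.beta_pos (by norm_num) (by positivity)
  have hcm : Measurable fun p : ℝ × Hypersphere m =>
      f (cons p.1 (√(1 - p.1 ^ 2) • (p.2 : EuclideanSpace ℝ (Fin (m + 1))))) :=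
    hf.comp (measurable_cons.comp (g := fun p : ℝ × EuclideanSpace ℝ (Fin (m + 1)) =>
      cons p.1 p.2) (f := fun p : ℝ × Hypersphere m =>
        (p.1, √(1 - p.1 ^ 2) • (p.2 : EuclideanSpace ℝ (Fin (m + 1))))) (by fun_prop))
  have hs0 : (volume : Measure (EuclideanSpace ℝ (Fin (m + 1)))).toSphere Set.univ ≠ 0 :=
    Measure.measure_univ_ne_zero.2 (Measure.toSphere_ne_zero _)
  rw [lintegral_projMeasure _ (Measurable.lintegral_prod_right' hcm)]
  unfold unifSphere
  simp only [lintegral_smul_measure, smul_eq_mul]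
  rw [lintegral_toSphere_slice m hf, toSphere_univ_slice,
    ENNReal.mul_inv (Or.inr (measure_ne_top _ _)) (Or.inl ENNReal.ofReal_ne_top),
    ← lintegral_const_mul' _ _ (ENNReal.mul_ne_top (by simpa using hb) (by simpa using hs0))]
  refine setLIntegral_congr_fun measurableSet_Ioo fun t ht => ?_
  simp only [projDensity]
  rw [ENNReal.ofReal_mul (by positivity), ENNReal.ofReal_inv_of_pos hb]
  ring

lemma unifSphere_slice (m : ℕ) {S : Set (EuclideanSpace ℝ (Fin (m + 1 + 1)))}
    (hS : MeasurableSet S) :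
    unifSphere (m + 1) {γ | (γ : EuclideanSpace ℝ (Fin (m + 1 + 1))) ∈ S} =
      ∫⁻ t, unifSphere m
        {ξ | cons t (√(1 - t ^ 2) • (ξ : EuclideanSpace ℝ (Fin (m + 1)))) ∈ S}
          ∂(projMeasure (m + 1)) := by
  have h := lintegral_unifSphere_slice m (f := S.indicator 1) (measurable_one.indicator hS)
  have h1 : ∀ γ : Hypersphere (m + 1), S.indicator (1 : EuclideanSpace ℝ (Fin (m + 1 + 1)) → ENNReal) (γ : EuclideanSpace ℝ _) =
      {γ : Hypersphere (m + 1) | (γ : EuclideanSpace ℝ _) ∈ S}.indicator 1 γ := fun _ => rfl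
  have h2 : ∀ (t : ℝ) (ξ : Hypersphere m), S.indicator (1 : EuclideanSpace ℝ (Fin (m + 1 + 1)) → ENNReal)
      (cons t (√(1 - t ^ 2) • (ξ : EuclideanSpace ℝ (Fin (m + 1))))) =
      {ξ : Hypersphere m | cons t (√(1 - t ^ 2) • (ξ : EuclideanSpace ℝ (Fin (m + 1)))) ∈
        S}.indicator 1 ξ := fun _ _ => rfl
  simp only [h1, h2] at h
  have hS' : MeasurableSet {γ : Hypersphere (m + 1) | (γ : EuclideanSpace ℝ _) ∈ S} :=
    measurable_subtype_coe hS
  rw [lintegral_indicator_one hS'] at h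
  rw [h]
  refine lintegral_congr fun t => lintegral_indicator_one ?_
  have : Measurable fun ξ : Hypersphere m =>
      cons t (√(1 - t ^ 2) • (ξ : EuclideanSpace ℝ (Fin (m + 1)))) :=
    measurable_cons.comp (f := fun ξ : Hypersphere m =>
      (t, √(1 - t ^ 2) • (ξ : EuclideanSpace ℝ (Fin (m + 1))))) (by fun_prop)
  exact this hS

/-- Inherited from the invariance of Lebesgue measure: composing with `L` commutes with the degree-0
extension and preserves the ball. -/
lemma lintegral_unifSphere_isometry (q : ℕ)
    (L : EuclideanSpace ℝ (Fin (q + 1)) ≃ₗᵢ[ℝ] EuclideanSpace ℝ (Fin (q + 1)))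
    {f : EuclideanSpace ℝ (Fin (q + 1)) → ENNReal} (hf : Measurable f) :
    ∫⁻ γ : Hypersphere q, f (L γ) ∂(unifSphere q) =
      ∫⁻ γ : Hypersphere q, f γ ∂(unifSphere q) := by
  have hi : Measurable fun r : ℝ => (Set.Iio (1 : ℝ)).indicator (1 : ℝ → ENNReal) r :=
    measurable_one.indicator measurableSet_Iio
  have hL : Measurable L := L.continuous.measurable
  have h1 := lintegral_radial (volume : Measure (EuclideanSpace ℝ (Fin (q + 1)))) hf
  have h2 := lintegral_radial (volume : Measure (EuclideanSpace ℝ (Fin (q + 1)))) (hf.comp hL)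
  rw [← L.measurePreserving.lintegral_comp (by fun_prop)] at h1
  simp only [LinearIsometryEquiv.norm_map, Function.comp_apply, map_smul] at h1 h2
  rw [h2] at h1
  have h3 := (ENNReal.mul_right_inj (radialMass_ne_zero _) (radialMass_ne_top _)).1 h1
  unfold unifSphere
  rw [lintegral_smul_measure, lintegral_smul_measure, h3]

lemma unifSphere_isometry (q : ℕ)
    (L : EuclideanSpace ℝ (Fin (q + 1)) ≃ₗᵢ[ℝ] EuclideanSpace ℝ (Fin (q + 1)))
    {S : Set (EuclideanSpace ℝ (Fin (q + 1)))} (hS : MeasurableSet S) :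
    unifSphere q {γ | L (γ : EuclideanSpace ℝ (Fin (q + 1))) ∈ S} =
      unifSphere q {γ | (γ : EuclideanSpace ℝ (Fin (q + 1))) ∈ S} := by
  have h := lintegral_unifSphere_isometry q L (f := S.indicator 1) (measurable_one.indicator hS)
  have h1 : MeasurableSet {γ : Hypersphere q | (γ : EuclideanSpace ℝ (Fin (q + 1))) ∈ S} :=
    measurable_subtype_coe hS
  have h2 : MeasurableSet {γ : Hypersphere q | L (γ : EuclideanSpace ℝ (Fin (q + 1))) ∈ S} :=
    (L.continuous.measurable.comp measurable_subtype_coe) hS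
  rw [← lintegral_indicator_one h1, ← lintegral_indicator_one h2]
  exact h

/-- The reflection in the hyperplane orthogonal to `v - w` exchanges the two vectors. It serves both
to move a point to the first axis and as the symmetry swapping `X` and `Y`. -/
lemma exists_isometry_map_eq {n : ℕ} {v w : EuclideanSpace ℝ (Fin n)} (h : ‖v‖ = ‖w‖) :
    ∃ L : EuclideanSpace ℝ (Fin n) ≃ₗᵢ[ℝ] EuclideanSpace ℝ (Fin n), L v = w ∧ L w = v := by
  have h1 := Submodule.reflection_sub h
  refine ⟨(Submodule.span ℝ {v - w})ᗮ.reflection, h1, ?_⟩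
  have h2 := Submodule.reflection_reflection (Submodule.span ℝ {v - w})ᗮ v
  rwa [h1] at h2

lemma norm_cons_one_zero {n : ℕ} : ‖cons 1 (0 : EuclideanSpace ℝ (Fin n))‖ = 1 := by
  have h := norm_cons_sq 1 (0 : EuclideanSpace ℝ (Fin n))
  rw [norm_zero] at h
  exact (pow_eq_one_iff_of_nonneg (norm_nonneg _) two_ne_zero).1 (by linarith)

lemma eq_cons {n : ℕ} (x : EuclideanSpace ℝ (Fin (n + 1))) :
    ∃ t y, x = cons t y :=
  ⟨x 0, WithLp.toLp 2 (fun i => x i.succ), by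
    ext i
    refine Fin.cases ?_ (fun j => ?_) i <;> simp⟩

instance (m : ℕ) : IsProbabilityMeasure (projMeasure (m + 1)) := by
  constructor
  have h := unifSphere_slice m (S := Set.univ) MeasurableSet.univ
  simpa using h.symm

/-- The projection of the uniform distribution on a line has distribution `F_q`. -/
lemma measurePreserving_inner (m : ℕ) (X : Hypersphere (m + 1)) :
    MeasurePreserving (fun γ : Hypersphere (m + 1) =>
      inner ℝ (γ : EuclideanSpace ℝ (Fin (m + 1 + 1))) (X : EuclideanSpace ℝ (Fin (m + 1 + 1))))
      (unifSphere (m + 1)) (projMeasure (m + 1)) := by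
  refine ⟨by fun_prop, ?_⟩
  ext B hB
  rw [Measure.map_apply (by fun_prop) hB]
  obtain ⟨L, hL, -⟩ := exists_isometry_map_eq
    (v := (X : EuclideanSpace ℝ (Fin (m + 1 + 1)))) (w := cons 1 0)
    (by rw [norm_cons_one_zero]; simp)
  have hS : MeasurableSet {x : EuclideanSpace ℝ (Fin (m + 1 + 1)) | inner ℝ x (cons 1 0) ∈ B} :=
    (by fun_prop : Measurable fun x : EuclideanSpace ℝ (Fin (m + 1 + 1)) =>
      inner ℝ x (cons 1 0)) hB
  have h := unifSphere_isometry (m + 1) L hS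
  simp only [Set.mem_ofPred_eq, ← hL, LinearIsometryEquiv.inner_map_map] at h
  rw [hL] at h
  refine h.trans ((unifSphere_slice m hS).trans ?_)
  rw [← lintegral_indicator_one hB]
  refine lintegral_congr fun t => ?_
  by_cases ht : t ∈ B <;> simp [inner_cons, ht]

/-! ### Caps: symmetry, inclusion-exclusion and halving -/

lemma measurableSet_cap {q : ℕ} (X : Hypersphere q) (x : ℝ) :
    MeasurableSet {γ : Hypersphere q | inner ℝ (γ : EuclideanSpace ℝ (Fin (q + 1))) X ≤ x} :=
  measurableSet_le (by fun_prop) measurable_const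

lemma measurableSet_inner_le_and {n : ℕ} (u v : EuclideanSpace ℝ (Fin n)) (x y : ℝ) :
    MeasurableSet {w : EuclideanSpace ℝ (Fin n) | inner ℝ w u ≤ x ∧ inner ℝ w v ≤ y} := by
  have h1 : MeasurableSet {w : EuclideanSpace ℝ (Fin n) | inner ℝ w u ≤ x} :=
    measurableSet_le (by fun_prop) measurable_const
  have h2 : MeasurableSet {w : EuclideanSpace ℝ (Fin n) | inner ℝ w v ≤ y} :=
    measurableSet_le (by fun_prop) measurable_const
  exact h1.inter h2

lemma measurableSet_inner_le_and_le {n : ℕ} (u v : EuclideanSpace ℝ (Fin n)) (x : ℝ) :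
    MeasurableSet {w : EuclideanSpace ℝ (Fin n) | inner ℝ w u ≤ x ∧ inner ℝ w v ≤ inner ℝ w u} := by
  have h1 : MeasurableSet {w : EuclideanSpace ℝ (Fin n) | inner ℝ w u ≤ x} :=
    measurableSet_le (by fun_prop) measurable_const
  have h2 : MeasurableSet {w : EuclideanSpace ℝ (Fin n) | inner ℝ w v ≤ inner ℝ w u} :=
    measurableSet_le (by fun_prop) (by fun_prop)
  exact h1.inter h2

lemma capProb_eq_real (q : ℕ) (X Y : Hypersphere q) (x : ℝ) :
    capProb q X Y x = (unifSphere q).real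
      ({γ | inner ℝ (γ : EuclideanSpace ℝ (Fin (q + 1))) X ≤ x} ∩
        {γ | inner ℝ (γ : EuclideanSpace ℝ (Fin (q + 1))) Y ≤ x}) :=
  integral_indicator_one ((measurableSet_cap X x).inter (measurableSet_cap Y x))

lemma projCdf_nonneg {q : ℕ} (hq : 1 ≤ q) (x : ℝ) : 0 ≤ projCdf q x :=
  intervalIntegral.integral_nonneg (le_max_left _ _) fun _ ht =>
    projDensity_nonneg hq ⟨ht.1, ht.2.trans (max_le (by norm_num) (min_le_right _ _))⟩

lemma projMeasure_real_Iic {q : ℕ} (hq : 1 ≤ q) (x : ℝ) :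
    (projMeasure q).real (Set.Iic x) = projCdf q x := by
  rw [measureReal_def, projMeasure_Iic hq, ENNReal.toReal_ofReal (projCdf_nonneg hq x)]

lemma unifSphere_real_cap (m : ℕ) (X : Hypersphere (m + 1)) (x : ℝ) :
    (unifSphere (m + 1)).real
      {γ | inner ℝ (γ : EuclideanSpace ℝ (Fin (m + 1 + 1))) X ≤ x} = projCdf (m + 1) x := by
  rw [← projMeasure_real_Iic (by omega), measureReal_def, measureReal_def,
    ← (measurePreserving_inner m X).measure_preimage measurableSet_Iic.nullMeasurableSet]
  rfl

/-- The law of a projection has no atoms, so strict and weak inequalities define the same caps up to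
null sets. -/
lemma ae_inner_ne (m : ℕ) (X : Hypersphere (m + 1)) (x : ℝ) :
    ∀ᵐ γ : Hypersphere (m + 1) ∂(unifSphere (m + 1)),
      inner ℝ (γ : EuclideanSpace ℝ (Fin (m + 1 + 1))) X ≠ x := by
  rw [ae_iff]
  have h := (measurePreserving_inner m X).measure_preimage
    (measurableSet_singleton x).nullMeasurableSet
  rw [measure_singleton] at h
  refine measure_mono_null (fun γ hγ => ?_) h
  simpa using hγ

lemma unifSphere_real_isometry (q : ℕ)
    (L : EuclideanSpace ℝ (Fin (q + 1)) ≃ₗᵢ[ℝ] EuclideanSpace ℝ (Fin (q + 1)))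
    {S : Set (EuclideanSpace ℝ (Fin (q + 1)))} (hS : MeasurableSet S) :
    (unifSphere q).real {γ | L (γ : EuclideanSpace ℝ (Fin (q + 1))) ∈ S} =
      (unifSphere q).real {γ | (γ : EuclideanSpace ℝ (Fin (q + 1))) ∈ S} := by
  rw [measureReal_def, measureReal_def, unifSphere_isometry q L hS]

lemma unifSphere_real_neg (q : ℕ) {S : Set (EuclideanSpace ℝ (Fin (q + 1)))}
    (hS : MeasurableSet S) :
    (unifSphere q).real {γ | -(γ : EuclideanSpace ℝ (Fin (q + 1))) ∈ S} =
      (unifSphere q).real {γ | (γ : EuclideanSpace ℝ (Fin (q + 1))) ∈ S} :=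
  unifSphere_real_isometry q (LinearIsometryEquiv.neg ℝ) hS

/-- The antipodal map sends the region at level `-x` to the complement, up to a null set, of the
union of the two caps at level `x`; inclusion-exclusion does the rest. -/
lemma capProb_neg (m : ℕ) (X Y : Hypersphere (m + 1)) (x : ℝ) :
    capProb (m + 1) X Y (-x) = capProb (m + 1) X Y x + 1 - 2 * projCdf (m + 1) x := by
  set A : Set (Hypersphere (m + 1)) :=
    {γ | inner ℝ (γ : EuclideanSpace ℝ (Fin (m + 1 + 1))) X ≤ x} with hA
  set B : Set (Hypersphere (m + 1)) :=
    {γ | inner ℝ (γ : EuclideanSpace ℝ (Fin (m + 1 + 1))) Y ≤ x} with hB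
  have hBm : MeasurableSet B := measurableSet_cap Y x
  have hAm : MeasurableSet A := measurableSet_cap X x
  have h1 := measureReal_union_add_inter (μ := unifSphere (m + 1)) (s := A) hBm
  have h2 := probReal_compl_eq_one_sub (μ := unifSphere (m + 1)) (hAm.union hBm)
  have hS : MeasurableSet {v : EuclideanSpace ℝ (Fin (m + 1 + 1)) |
      inner ℝ v (X : EuclideanSpace ℝ (Fin (m + 1 + 1))) ≤ -x ∧
      inner ℝ v (Y : EuclideanSpace ℝ (Fin (m + 1 + 1))) ≤ -x} :=
    measurableSet_inner_le_and _ _ _ _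
  have h3 : capProb (m + 1) X Y (-x) = (unifSphere (m + 1)).real (A ∪ B)ᶜ := by
    rw [capProb_eq_real]
    refine (unifSphere_real_neg (m + 1) hS).symm.trans (measureReal_congr ?_)
    filter_upwards [ae_inner_ne m X x, ae_inner_ne m Y x] with γ hX hY
    refine propext ?_
    change (inner ℝ (-(γ : EuclideanSpace ℝ (Fin (m + 1 + 1)))) (X : EuclideanSpace ℝ _) ≤ -x ∧
      inner ℝ (-(γ : EuclideanSpace ℝ (Fin (m + 1 + 1)))) (Y : EuclideanSpace ℝ _) ≤ -x) ↔
      ¬ (inner ℝ (γ : EuclideanSpace ℝ (Fin (m + 1 + 1))) (X : EuclideanSpace ℝ _) ≤ x ∨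
        inner ℝ (γ : EuclideanSpace ℝ (Fin (m + 1 + 1))) (Y : EuclideanSpace ℝ _) ≤ x)
    rw [inner_neg_left, inner_neg_left, neg_le_neg_iff, neg_le_neg_iff, not_or, not_le, not_le]
    exact ⟨fun h => ⟨lt_of_le_of_ne h.1 hX.symm, lt_of_le_of_ne h.2 hY.symm⟩,
      fun h => ⟨h.1.le, h.2.le⟩⟩
  rw [h3, h2, capProb_eq_real]
  rw [unifSphere_real_cap m X x, unifSphere_real_cap m Y x] at h1
  linarith

/-- A point outside both caps would satisfy `γ'(X + Y) > 2x`, against Cauchy-Schwarz. Hence the caps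
cover the sphere. -/
lemma capProb_of_disjoint (m : ℕ) (X Y : Hypersphere (m + 1)) {x : ℝ}
    (h : ‖(X + Y : EuclideanSpace ℝ (Fin (m + 1 + 1)))‖ ≤ 2 * x) :
    capProb (m + 1) X Y x = 2 * projCdf (m + 1) x - 1 := by
  have h1 := measureReal_union_add_inter (μ := unifSphere (m + 1))
    (s := {γ | inner ℝ (γ : EuclideanSpace ℝ (Fin (m + 1 + 1))) X ≤ x}) (measurableSet_cap Y x)
  have h2 : {γ : Hypersphere (m + 1) | inner ℝ (γ : EuclideanSpace ℝ (Fin (m + 1 + 1))) X ≤ x} ∪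
      {γ | inner ℝ (γ : EuclideanSpace ℝ (Fin (m + 1 + 1))) Y ≤ x} = Set.univ := by
    refine Set.eq_univ_of_forall fun γ => ?_
    by_contra hγ
    change ¬ (inner ℝ (γ : EuclideanSpace ℝ (Fin (m + 1 + 1))) (X : EuclideanSpace ℝ _) ≤ x ∨
        inner ℝ (γ : EuclideanSpace ℝ (Fin (m + 1 + 1))) (Y : EuclideanSpace ℝ _) ≤ x) at hγ
    rw [not_or, not_le, not_le] at hγ
    have h3 := real_inner_le_norm (γ : EuclideanSpace ℝ (Fin (m + 1 + 1)))
      (X + Y : EuclideanSpace ℝ (Fin (m + 1 + 1)))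
    have h4 : ‖(γ : EuclideanSpace ℝ (Fin (m + 1 + 1)))‖ = 1 := by simp
    rw [inner_add_right, h4, one_mul] at h3
    linarith [hγ.1, hγ.2]
  rw [h2, probReal_univ, unifSphere_real_cap m X x, unifSphere_real_cap m Y x,
    ← capProb_eq_real] at h1
  linarith

lemma norm_add_eq_two_mul_cos {q : ℕ} (X Y : Hypersphere q) :
    ‖(X + Y : EuclideanSpace ℝ (Fin (q + 1)))‖ = 2 * Real.cos (Real.arccos
      (inner ℝ (X : EuclideanSpace ℝ (Fin (q + 1))) (Y : EuclideanSpace ℝ (Fin (q + 1)))) / 2) := by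
  have hX : ‖(X : EuclideanSpace ℝ (Fin (q + 1)))‖ = 1 := by simp
  have hY : ‖(Y : EuclideanSpace ℝ (Fin (q + 1)))‖ = 1 := by simp
  have h1 := norm_add_sq_real (X : EuclideanSpace ℝ (Fin (q + 1))) Y
  have h2 := abs_real_inner_le_norm (X : EuclideanSpace ℝ (Fin (q + 1))) Y
  rw [hX, hY] at h1 h2
  obtain ⟨h3, h4⟩ := abs_le.1 h2
  set θ := Real.arccos
    (inner ℝ (X : EuclideanSpace ℝ (Fin (q + 1))) (Y : EuclideanSpace ℝ (Fin (q + 1)))) with hθ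
  have h5 : Real.cos θ = inner ℝ (X : EuclideanSpace ℝ (Fin (q + 1))) Y :=
    Real.cos_arccos (by linarith) (by linarith)
  have h6 : 0 ≤ Real.cos (θ / 2) := Real.cos_nonneg_of_neg_pi_div_two_le_of_le
    (by linarith [Real.arccos_nonneg (inner ℝ (X : EuclideanSpace ℝ (Fin (q + 1)))
      (Y : EuclideanSpace ℝ (Fin (q + 1)))), Real.pi_pos])
    (by linarith [Real.arccos_le_pi (inner ℝ (X : EuclideanSpace ℝ (Fin (q + 1)))
      (Y : EuclideanSpace ℝ (Fin (q + 1))))])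
  have h7 := Real.cos_sq (θ / 2)
  rw [mul_div_cancel₀ _ two_ne_zero, h5] at h7
  refine (pow_left_inj₀ (norm_nonneg _) (by positivity) two_ne_zero).1 ?_
  rw [h1, mul_pow, h7]
  ring

/-- When the band `|ξ'Z| ≤ u` is null, the antipodal map exchanges the cap and its complement.
Allowing `u > 0` is needed for the two-point sphere. -/
lemma unifSphere_real_cap_eq_half {q : ℕ} (Z : Hypersphere q) {u : ℝ} (hu : 0 ≤ u)
    (h : ∀ᵐ ξ : Hypersphere q ∂(unifSphere q),
      u < |inner ℝ (ξ : EuclideanSpace ℝ (Fin (q + 1))) (Z : EuclideanSpace ℝ (Fin (q + 1)))|) :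
    (unifSphere q).real {ξ | inner ℝ (ξ : EuclideanSpace ℝ (Fin (q + 1))) Z ≤ u} = 1 / 2 := by
  have hS : MeasurableSet {v : EuclideanSpace ℝ (Fin (q + 1)) |
      inner ℝ v (Z : EuclideanSpace ℝ (Fin (q + 1))) ≤ u} :=
    measurableSet_le (by fun_prop) measurable_const
  have h1 := unifSphere_real_neg q hS
  have h2 := probReal_compl_eq_one_sub (μ := unifSphere q) (measurableSet_cap Z u)
  have h3 : (unifSphere q).real
      {γ | -(γ : EuclideanSpace ℝ (Fin (q + 1))) ∈ {v : EuclideanSpace ℝ (Fin (q + 1)) |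
        inner ℝ v (Z : EuclideanSpace ℝ (Fin (q + 1))) ≤ u}} = (unifSphere q).real
      {ξ | inner ℝ (ξ : EuclideanSpace ℝ (Fin (q + 1))) Z ≤ u}ᶜ := by
    refine measureReal_congr ?_
    filter_upwards [h] with ξ hξ
    refine propext ?_
    change inner ℝ (-(ξ : EuclideanSpace ℝ (Fin (q + 1)))) (Z : EuclideanSpace ℝ _) ≤ u ↔
      ¬ inner ℝ (ξ : EuclideanSpace ℝ (Fin (q + 1))) (Z : EuclideanSpace ℝ _) ≤ u
    rw [inner_neg_left, not_le]
    rcases lt_abs.1 hξ with h | h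
    · exact ⟨fun _ => h, fun _ => by linarith⟩
    · exact ⟨fun _ => by linarith, fun _ => by linarith⟩
  rw [h3, h2] at h1
  simp only [Set.mem_ofPred_eq] at h1
  linarith

/-- Split by the larger of the two inner products. The reflection exchanging `X` and `Y` swaps the
halves, which overlap in a subset of the null great subsphere orthogonal to `X - Y`. -/
lemma capProb_eq_two_mul (m : ℕ) {X Y : Hypersphere (m + 1)} (hXY : X ≠ Y) (x : ℝ) :
    capProb (m + 1) X Y x = 2 * (unifSphere (m + 1)).real
      {γ | inner ℝ (γ : EuclideanSpace ℝ (Fin (m + 1 + 1))) X ≤ x ∧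
        inner ℝ (γ : EuclideanSpace ℝ (Fin (m + 1 + 1))) Y ≤
          inner ℝ (γ : EuclideanSpace ℝ (Fin (m + 1 + 1))) (X : EuclideanSpace ℝ _)} := by
  set C : Set (Hypersphere (m + 1)) :=
    {γ | inner ℝ (γ : EuclideanSpace ℝ (Fin (m + 1 + 1))) X ≤ x ∧
        inner ℝ (γ : EuclideanSpace ℝ (Fin (m + 1 + 1))) Y ≤
          inner ℝ (γ : EuclideanSpace ℝ (Fin (m + 1 + 1))) (X : EuclideanSpace ℝ _)} with hC
  set D : Set (Hypersphere (m + 1)) :=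
    {γ | inner ℝ (γ : EuclideanSpace ℝ (Fin (m + 1 + 1))) Y ≤ x ∧
        inner ℝ (γ : EuclideanSpace ℝ (Fin (m + 1 + 1))) X ≤
          inner ℝ (γ : EuclideanSpace ℝ (Fin (m + 1 + 1))) (Y : EuclideanSpace ℝ _)} with hD
  have hDm : MeasurableSet D :=
    measurable_subtype_coe (measurableSet_inner_le_and_le Y.1 X.1 x)
  have hsub : (X - Y : EuclideanSpace ℝ (Fin (m + 1 + 1))) ≠ 0 :=
    sub_ne_zero.2 fun h => hXY (Subtype.ext h)
  have hnorm : ‖(X - Y : EuclideanSpace ℝ (Fin (m + 1 + 1)))‖ ≠ 0 := norm_ne_zero_iff.2 hsub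
  have hunion : C ∪ D = {γ : Hypersphere (m + 1) | inner ℝ (γ : EuclideanSpace ℝ (Fin (m + 1 + 1))) X ≤ x} ∩
        {γ | inner ℝ (γ : EuclideanSpace ℝ (Fin (m + 1 + 1))) Y ≤ x} := by
    ext γ
    simp only [hC, hD, Set.mem_union, Set.mem_inter_iff, Set.mem_ofPred_eq]
    constructor
    · rintro (⟨h1, h2⟩ | ⟨h1, h2⟩)
      · exact ⟨h1, h2.trans h1⟩
      · exact ⟨h2.trans h1, h1⟩
    · rintro ⟨h1, h2⟩
      rcases le_total (inner ℝ (γ : EuclideanSpace ℝ (Fin (m + 1 + 1))) (Y : EuclideanSpace ℝ _))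
        (inner ℝ (γ : EuclideanSpace ℝ (Fin (m + 1 + 1))) (X : EuclideanSpace ℝ _)) with h | h
      · exact Or.inl ⟨h1, h⟩
      · exact Or.inr ⟨h2, h⟩
  have hnull : (unifSphere (m + 1)).real (C ∩ D) = 0 := by
    set W : Hypersphere (m + 1) := ⟨‖(X - Y : EuclideanSpace ℝ (Fin (m + 1 + 1)))‖⁻¹ •
      (X - Y : EuclideanSpace ℝ (Fin (m + 1 + 1))), by simp [norm_smul, hnorm]⟩ with hW
    have h0 : unifSphere (m + 1) (C ∩ D) = 0 := by
      refine measure_mono_null ?_ (ae_iff.1 (ae_inner_ne m W 0))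
      rintro γ ⟨⟨-, h1⟩, ⟨-, h2⟩⟩
      simp only [hW, ne_eq, not_not, Set.mem_ofPred_eq, inner_smul_right, inner_sub_right]
      rw [le_antisymm h1 h2, sub_self, mul_zero]
    rw [measureReal_def, h0, ENNReal.toReal_zero]
  have hswap : (unifSphere (m + 1)).real D = (unifSphere (m + 1)).real C := by
    obtain ⟨L, hL1, hL2⟩ := exists_isometry_map_eq
      (v := (X : EuclideanSpace ℝ (Fin (m + 1 + 1))))
      (w := (Y : EuclideanSpace ℝ (Fin (m + 1 + 1)))) (by simp)
    have hS : MeasurableSet {v : EuclideanSpace ℝ (Fin (m + 1 + 1)) |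
        inner ℝ v (X : EuclideanSpace ℝ (Fin (m + 1 + 1))) ≤ x ∧
        inner ℝ v (Y : EuclideanSpace ℝ (Fin (m + 1 + 1))) ≤
          inner ℝ v (X : EuclideanSpace ℝ (Fin (m + 1 + 1)))} :=
      measurableSet_inner_le_and_le _ _ _
    refine Eq.trans ?_ (unifSphere_real_isometry (m + 1) L hS)
    congr 1
    ext γ
    have e1 := L.inner_map_map (γ : EuclideanSpace ℝ (Fin (m + 1 + 1))) Y
    have e2 := L.inner_map_map (γ : EuclideanSpace ℝ (Fin (m + 1 + 1))) X
    rw [hL2] at e1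
    rw [hL1] at e2
    simp only [hD, Set.mem_ofPred_eq, e1, e2]
  have h := measureReal_union_add_inter (μ := unifSphere (m + 1)) (s := C) hDm
  rw [hnull, hswap, hunion, ← capProb_eq_real] at h
  linarith

/-! ### Conditioning on one projection -/

/-- The probability that a uniform point `ξ` of the sphere satisfies `ξ'Z ≤ u`. -/
def sphereCdf {q : ℕ} (Z : Hypersphere q) (u : ℝ) : ℝ :=
  (unifSphere q).real {ξ | inner ℝ (ξ : EuclideanSpace ℝ (Fin (q + 1))) Z ≤ u}

lemma sphereCdf_mono {q : ℕ} (Z : Hypersphere q) : Monotone (sphereCdf Z) :=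
  fun _ _ huv => measureReal_mono fun _ hξ => le_trans hξ huv

lemma sphereCdf_comp_integrable {q : ℕ} (Z : Hypersphere q) {u : ℝ → ℝ} (hu : Measurable u)
    (μ : Measure ℝ) [IsFiniteMeasure μ] : Integrable (fun t => sphereCdf Z (u t)) μ :=
  Integrable.of_bound ((sphereCdf_mono Z).measurable.comp hu).aestronglyMeasurable 1
    (Filter.Eventually.of_forall fun t => by
      rw [Real.norm_eq_abs, sphereCdf, abs_of_nonneg measureReal_nonneg]
      exact measureReal_le_one)

/-- The bridge to `F_{q-1}` exists only from dimension one on; on the two-point sphere `sphereCdf`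
is evaluated directly, which lets the conditioning formula include the circle. -/
lemma sphereCdf_eq_projCdf {m : ℕ} (Z : Hypersphere (m + 1)) (u : ℝ) :
    sphereCdf Z u = projCdf (m + 1) u := unifSphere_real_cap m Z u

lemma abs_inner_of_zero_sphere (Z ξ : Hypersphere 0) :
    |inner ℝ (ξ : EuclideanSpace ℝ (Fin (0 + 1))) (Z : EuclideanSpace ℝ (Fin (0 + 1)))| = 1 := by
  have hZ : ‖(Z : EuclideanSpace ℝ (Fin (0 + 1)))‖ = 1 := by simp
  have hξ : ‖(ξ : EuclideanSpace ℝ (Fin (0 + 1)))‖ = 1 := by simp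
  have hs : Subsingleton (Fin (0 + 1)) := inferInstanceAs (Subsingleton (Fin 1))
  rw [EuclideanSpace.norm_eq] at hZ hξ
  rw [Fintype.sum_eq_single 0 (fun i hi => absurd (Subsingleton.elim i 0) hi),
    Real.sqrt_sq (norm_nonneg _), Real.norm_eq_abs] at hZ hξ
  rw [PiLp.inner_apply, Fintype.sum_eq_single 0 (fun i hi => absurd (Subsingleton.elim i 0) hi)]
  simp only [RCLike.inner_apply, conj_trivial, abs_mul, hZ, hξ, mul_one]

lemma sphereCdf_zero_sphere (Z : Hypersphere 0) {u : ℝ} (h0 : 0 ≤ u) (h1 : u < 1) :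
    sphereCdf Z u = 1 / 2 :=
  unifSphere_real_cap_eq_half Z h0 (Filter.Eventually.of_forall fun ξ => by
    rw [abs_inner_of_zero_sphere]
    exact h1)

lemma sphereCdf_zero {q : ℕ} (Z : Hypersphere q) : sphereCdf Z 0 = 1 / 2 := by
  cases q with
  | zero => exact sphereCdf_zero_sphere Z le_rfl one_pos
  | succ m =>
    refine unifSphere_real_cap_eq_half Z le_rfl ?_
    filter_upwards [ae_inner_ne m Z 0] with ξ hξ
    exact abs_pos.2 hξ

lemma tan_half_eq {θ : ℝ} (h : 0 < Real.sin θ) :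
    Real.tan (θ / 2) = (1 - Real.cos θ) / Real.sin θ := by
  have h1 : Real.sin θ = 2 * Real.sin (θ / 2) * Real.cos (θ / 2) := by
    rw [← Real.sin_two_mul, mul_div_cancel₀ _ two_ne_zero]
  have h2 : Real.cos θ = 2 * Real.cos (θ / 2) ^ 2 - 1 := by
    rw [← Real.cos_two_mul, mul_div_cancel₀ _ two_ne_zero]
  have h3 : Real.cos (θ / 2) ≠ 0 := fun h0 => by rw [h1, h0, mul_zero] at h; exact h.false
  rw [Real.tan_eq_sin_div_cos, div_eq_div_iff h3 h.ne', h1, h2]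
  have := Real.sin_sq_add_cos_sq (θ / 2)
  linear_combination 2 * Real.cos (θ / 2) * this

lemma real_inner_mem_Icc {q : ℕ} (X Y : Hypersphere q) :
    inner ℝ (X : EuclideanSpace ℝ (Fin (q + 1))) (Y : EuclideanSpace ℝ (Fin (q + 1))) ∈
      Set.Icc (-1 : ℝ) 1 := by
  have h := abs_real_inner_le_norm (X : EuclideanSpace ℝ (Fin (q + 1))) Y
  have hX : ‖(X : EuclideanSpace ℝ (Fin (q + 1)))‖ = 1 := by simp
  have hY : ‖(Y : EuclideanSpace ℝ (Fin (q + 1)))‖ = 1 := by simp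
  rw [hX, hY, one_mul] at h
  exact abs_le.1 h

lemma capProb_self (m : ℕ) (X : Hypersphere (m + 1)) (x : ℝ) :
    capProb (m + 1) X X x = projCdf (m + 1) x := by
  rw [capProb_eq_real, Set.inter_self, unifSphere_real_cap m X x]

/-- Conditioning on the projection on `X`. -/
lemma capProb_eq_integral_Iic (m : ℕ) (X Y : Hypersphere (m + 1)) {θ : ℝ}
    (hθ : θ = Real.arccos (inner ℝ (X : EuclideanSpace ℝ (Fin (m + 1 + 1)))
      (Y : EuclideanSpace ℝ (Fin (m + 1 + 1))))) (hπ : θ < Real.pi) :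
    ∃ Z : Hypersphere m, ∀ x : ℝ, capProb (m + 1) X Y x =
      2 * ∫ t in Set.Iic x, sphereCdf Z (t * Real.tan (θ / 2) / √(1 - t ^ 2))
        ∂(projMeasure (m + 1)) := by
  have hmem := real_inner_mem_Icc X Y
  have hX : ‖(X : EuclideanSpace ℝ (Fin (m + 1 + 1)))‖ = 1 := by simp
  have hY : ‖(Y : EuclideanSpace ℝ (Fin (m + 1 + 1)))‖ = 1 := by simp
  have hcos : Real.cos θ = inner ℝ (X : EuclideanSpace ℝ (Fin (m + 1 + 1)))
      (Y : EuclideanSpace ℝ (Fin (m + 1 + 1))) := by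
    rw [hθ, Real.cos_arccos hmem.1 hmem.2]
  rcases (show 0 ≤ θ by rw [hθ]; exact Real.arccos_nonneg _).eq_or_lt with h0 | h0
  -- For `X = Y` halving fails, but the argument of `sphereCdf` is `0`, its value `1 / 2`, and any
  -- `Z` works.
  · have hXY : X = Y := by
      rw [← h0, Real.cos_zero] at hcos
      exact Subtype.ext ((inner_eq_one_iff_of_norm_eq_one hX hY).1 hcos.symm)
    obtain ⟨Z⟩ : Nonempty (Hypersphere m) :=
      (NormedSpace.sphere_nonempty.2 zero_le_one).to_subtype
    refine ⟨Z, fun x => ?_⟩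
    simp only [← h0, zero_div, Real.tan_zero, mul_zero, sphereCdf_zero, ← hXY, capProb_self,
      setIntegral_const, projMeasure_real_Iic (show 1 ≤ m + 1 by omega), smul_eq_mul]
    ring
  · have hsin : 0 < Real.sin θ := Real.sin_pos_of_pos_of_lt_pi h0 hπ
    have hXY : X ≠ Y := by
      rintro rfl
      rw [real_inner_self_eq_norm_sq, hX] at hθ
      norm_num at hθ
      exact h0.ne' hθ
    obtain ⟨L, hL, -⟩ := exists_isometry_map_eq
      (v := (X : EuclideanSpace ℝ (Fin (m + 1 + 1)))) (w := cons 1 0)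
      (by rw [norm_cons_one_zero, hX])
    obtain ⟨c, y, hy⟩ := eq_cons (L Y)
    have hc : c = Real.cos θ := by
      rw [hcos, ← L.inner_map_map, hL, hy, inner_cons]
      simp
    have hyn : ‖y‖ = Real.sin θ := by
      have h := norm_cons_sq c y
      rw [← hy, L.norm_map, hY, hc] at h
      have h2 := Real.sin_sq_add_cos_sq θ
      exact (pow_left_inj₀ (norm_nonneg _) hsin.le two_ne_zero).1 (by linarith)
    -- After `X` is rotated to the first axis, `Z` is the normalized orthogonal part of `Y`, whose
    -- length is `sin θ`.
    set Z : Hypersphere m := ⟨(Real.sin θ)⁻¹ • y, by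
      simp [norm_smul, hyn, abs_of_pos hsin, hsin.ne']⟩ with hZ
    have hyZ : y = Real.sin θ • (Z : EuclideanSpace ℝ (Fin (m + 1))) := by
      rw [hZ, smul_inv_smul₀ hsin.ne']
    refine ⟨Z, fun x => ?_⟩
    rw [capProb_eq_two_mul m hXY]
    congr 1
    have hS := measurableSet_inner_le_and_le (cons 1 (0 : EuclideanSpace ℝ (Fin (m + 1))))
      (cons c y) x
    have e1 := unifSphere_isometry (m + 1) L hS
    simp only [Set.mem_ofPred_eq, ← hy, ← hL, LinearIsometryEquiv.inner_map_map] at e1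
    rw [measureReal_def, e1, hL, hy]
    have e2 := unifSphere_slice m hS
    simp only [Set.mem_ofPred_eq] at e2
    rw [e2]
    have e3 : ∫⁻ t, unifSphere m
        {ξ | inner ℝ (cons t (√(1 - t ^ 2) • (ξ : EuclideanSpace ℝ (Fin (m + 1))))) (cons 1 0) ≤ x ∧
          inner ℝ (cons t (√(1 - t ^ 2) • (ξ : EuclideanSpace ℝ (Fin (m + 1))))) (cons c y) ≤
          inner ℝ (cons t (√(1 - t ^ 2) • (ξ : EuclideanSpace ℝ (Fin (m + 1))))) (cons 1 0)}
          ∂(projMeasure (m + 1)) =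
        ∫⁻ t in Set.Iic x, ENNReal.ofReal
          (sphereCdf Z (t * Real.tan (θ / 2) / √(1 - t ^ 2))) ∂(projMeasure (m + 1)) := by
      rw [← lintegral_indicator measurableSet_Iic]
      refine lintegral_congr_ae ?_
      filter_upwards [ae_projMeasure_mem_Ioo (m + 1)] with t ht
      have hw : 0 < √(1 - t ^ 2) := Real.sqrt_pos.2 (by nlinarith [ht.1, ht.2])
      by_cases htx : t ≤ x
      · rw [Set.indicator_of_mem (Set.mem_Iic.2 htx), sphereCdf, measureReal_def,
          ENNReal.ofReal_toReal (measure_ne_top _ _)]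
        congr 1
        ext ξ
        -- On the slice the condition is `t cos θ + √(1 - t²) sin θ ξ'Z ≤ t`; the quotient `(1 - cos
        -- θ) / sin θ` is `tan (θ / 2)`.
        simp only [inner_cons, inner_zero_right, mul_one, add_zero, htx, true_and,
          Set.mem_ofPred_eq, hyZ, inner_smul_left, inner_smul_right, hc, tan_half_eq hsin]
        rw [le_div_iff₀ hw, mul_div_assoc', le_div_iff₀ hsin, ← le_sub_iff_add_le']
        simp only [conj_trivial]
        constructor <;> intro h <;> linarith
      · rw [Set.indicator_of_notMem (show t ∉ Set.Iic x from htx)]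
        simp [inner_cons, htx]
    rw [e3]
    have hint := sphereCdf_comp_integrable Z
      (u := fun t => t * Real.tan (θ / 2) / √(1 - t ^ 2)) (by fun_prop)
      ((projMeasure (m + 1)).restrict (Set.Iic x))
    rw [← ofReal_integral_eq_lintegral_ofReal hint
      (Filter.Eventually.of_forall fun _ => measureReal_nonneg), ENNReal.toReal_ofReal]
    exact integral_nonneg fun _ => measureReal_nonneg

/-- The function `t / √(1 - t²)` increases on `[0, 1)` and equals `cot φ` at `t = cos φ`. -/
lemma mul_tan_div_sqrt_mem_Ico {t φ : ℝ} (ht : 0 ≤ t) (hφ : 0 ≤ φ) (hφ' : φ < Real.pi / 2)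
    (h : t < Real.cos φ) : t * Real.tan φ / √(1 - t ^ 2) ∈ Set.Ico (0 : ℝ) 1 := by
  have hc : 0 < Real.cos φ := ht.trans_lt h
  have h1 : t < 1 := h.trans_le (Real.cos_le_one φ)
  have hw : 0 < √(1 - t ^ 2) := Real.sqrt_pos.2 (by nlinarith)
  have htan : 0 ≤ Real.tan φ := Real.tan_nonneg_of_nonneg_of_le_pi_div_two hφ hφ'.le
  refine ⟨by positivity, ?_⟩
  rw [div_lt_one hw]
  refine Real.lt_sqrt_of_sq_lt ?_
  rw [Real.tan_eq_sin_div_cos, mul_div_assoc', div_pow, div_lt_iff₀ (by positivity)]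
  have h2 := Real.sin_sq_add_cos_sq φ
  have h3 : t ^ 2 < Real.cos φ ^ 2 := by gcongr
  have h4 : Real.sin φ ^ 2 = 1 - Real.cos φ ^ 2 := by linarith
  rw [mul_pow, h4]
  linarith

/-! ### The circle and the two-hemisphere probability -/

lemma projCdf_one_eq {x : ℝ} (h0 : -1 ≤ x) (h1 : x ≤ 1) :
    projCdf 1 x = 1 - Real.arccos x / Real.pi := by
  have hb : ProbabilityTheory.beta (1 / 2) (((1 : ℕ) : ℝ) / 2) = Real.pi := by
    rw [ProbabilityTheory.beta, Nat.cast_one, add_halves, Real.Gamma_one, Real.Gamma_one_half_eq,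
      div_one, Real.mul_self_sqrt Real.pi_pos.le]
  have hi : IntervalIntegrable (projDensity 1) volume (-1) x := by
    rw [intervalIntegrable_iff_integrableOn_Ioc_of_le h0]
    exact (projDensity_integrableOn le_rfl).mono_set (Set.Ioc_subset_Ioc_right h1)
  rw [projCdf, min_eq_left h1, max_eq_right h0,
    intervalIntegral.integral_eq_sub_of_hasDerivAt_of_le h0
      (f := fun t => Real.arcsin t / Real.pi) (by fun_prop) (fun t ht => ?_) hi]
  · rw [Real.arcsin_neg_one, Real.arccos]
    field_simp
    ring
  · have h2 : 0 < 1 - t ^ 2 := by nlinarith [ht.1, ht.2]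
    refine ((Real.hasDerivAt_arcsin (by linarith [ht.1]) (by linarith [ht.2])).div_const
      Real.pi).congr_deriv ?_
    rw [projDensity, hb, show ((1 : ℕ) : ℝ) / 2 - 1 = -(1 / 2) by norm_num, Real.rpow_neg h2.le,
      ← Real.sqrt_eq_rpow]
    field_simp

lemma setIntegral_Iic_eq_add {μ : Measure ℝ} {g : ℝ → ℝ} (hg : Integrable g μ) (a b : ℝ) :
    ∫ t in Set.Iic b, g t ∂μ = ∫ t in Set.Iic a, g t ∂μ + ∫ t in a..b, g t ∂μ := by
  rw [← intervalIntegral.integral_Iic_sub_Iic hg.integrableOn hg.integrableOn]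
  ring

lemma projMeasure_setIntegral_Iic (q : ℕ) (g : ℝ → ℝ) {x : ℝ} (hx : -1 ≤ x) :
    ∫ t in Set.Iic x, g t ∂(projMeasure q) = ∫ t in (-1 : ℝ)..x, g t ∂(projMeasure q) := by
  rw [intervalIntegral.integral_of_le hx]
  refine setIntegral_congr_set ?_
  filter_upwards [ae_projMeasure_mem_Ioo q] with t ht
  refine propext ?_
  change t ≤ x ↔ -1 < t ∧ t ≤ x
  exact ⟨fun h => ⟨ht.1, h⟩, fun h => h.2⟩

lemma projMeasure_real_Ioc {q : ℕ} (hq : 1 ≤ q) [IsFiniteMeasure (projMeasure q)] {a b : ℝ}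
    (hab : a ≤ b) : (projMeasure q).real (Set.Ioc a b) = projCdf q b - projCdf q a := by
  rw [← Set.Iic_sdiff_Iic, measureReal_sdiff (Set.Iic_subset_Iic.2 hab) measurableSet_Iic,
    projMeasure_real_Iic hq, projMeasure_real_Iic hq]

lemma projCdf_zero (m : ℕ) : projCdf (m + 1) 0 = 1 / 2 := by
  obtain ⟨Z⟩ : Nonempty (Hypersphere (m + 1)) :=
    (NormedSpace.sphere_nonempty.2 zero_le_one).to_subtype
  rw [← sphereCdf_eq_projCdf Z, sphereCdf_zero]

lemma capProb_circle (X Y : Hypersphere (0 + 1)) {θ x : ℝ}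
    (hθ : θ = Real.arccos (inner ℝ (X : EuclideanSpace ℝ (Fin (0 + 1 + 1)))
      (Y : EuclideanSpace ℝ (Fin (0 + 1 + 1))))) (hx0 : 0 ≤ x) (hx : x ≤ Real.cos (θ / 2)) :
    capProb (0 + 1) X Y x = 1 - θ / (2 * Real.pi) - Real.arccos x / Real.pi := by
  have hθ0 : 0 ≤ θ := by rw [hθ]; exact Real.arccos_nonneg _
  have hθπ : θ ≤ Real.pi := by rw [hθ]; exact Real.arccos_le_pi _
  have hnorm := norm_add_eq_two_mul_cos X Y
  rw [← hθ] at hnorm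
  have hc := capProb_of_disjoint 0 X Y hnorm.le
  have hcF : projCdf (0 + 1) (Real.cos (θ / 2)) = 1 - θ / (2 * Real.pi) := by
    rw [zero_add, projCdf_one_eq (Real.neg_one_le_cos _) (Real.cos_le_one _),
      Real.arccos_cos (by linarith) (by linarith)]
    field_simp
  have hxF : projCdf (0 + 1) x = 1 - Real.arccos x / Real.pi := by
    rw [zero_add, projCdf_one_eq (by linarith) (hx.trans (Real.cos_le_one _))]
  -- At level `cos (θ / 2)` the value is known from disjointness, so only the increment from `x` is
  -- needed.
  suffices h : capProb (0 + 1) X Y (Real.cos (θ / 2)) = capProb (0 + 1) X Y x +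
      (projCdf (0 + 1) (Real.cos (θ / 2)) - projCdf (0 + 1) x) by
    rw [hc, hcF, hxF] at h
    linarith
  rcases hx.eq_or_lt with rfl | hlt
  · simp
  have hlt' : θ < Real.pi := by
    refine lt_of_le_of_ne hθπ fun h => ?_
    rw [h, Real.cos_pi_div_two] at hlt
    linarith
  obtain ⟨Z, hZ⟩ := capProb_eq_integral_Iic 0 X Y hθ hlt'
  have hint := sphereCdf_comp_integrable Z
    (u := fun t => t * Real.tan (θ / 2) / √(1 - t ^ 2)) (by fun_prop) (projMeasure (0 + 1))
  rw [hZ, hZ, setIntegral_Iic_eq_add hint x, intervalIntegral.integral_of_le hx,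
    ← projMeasure_real_Ioc (by omega) hx, mul_add]
  congr 1
  -- The right endpoint is dropped because there the argument may reach `1`, where the two-point
  -- distribution function jumps.
  rw [integral_Ioc_eq_integral_Ioo, setIntegral_congr_fun (g := fun _ => (1 / 2 : ℝ))
    measurableSet_Ioo, ← integral_Ioc_eq_integral_Ioo, setIntegral_const, smul_eq_mul]
  · ring
  · intro t ht
    have h := mul_tan_div_sqrt_mem_Ico (hx0.trans ht.1.le) (by linarith : 0 ≤ θ / 2)
      (by linarith) ht.2
    exact sphereCdf_zero_sphere Z h.1 h.2

lemma exists_unit_orthogonal {n : ℕ} (u v : EuclideanSpace ℝ (Fin (n + 3))) :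
    ∃ e : EuclideanSpace ℝ (Fin (n + 3)), ‖e‖ = 1 ∧ inner ℝ e u = 0 ∧ inner ℝ e v = 0 := by
  classical
  set K : Submodule ℝ (EuclideanSpace ℝ (Fin (n + 3))) := Submodule.span ℝ {u, v} with hK
  have h1 : Module.finrank ℝ K ≤ 2 := by
    have := finrank_span_finset_le_card (R := ℝ) ({u, v} : Finset (EuclideanSpace ℝ (Fin (n + 3))))
    rw [Set.finrank, Finset.coe_pair] at this
    exact this.trans Finset.card_le_two
  have h2 := K.finrank_add_finrank_orthogonal
  rw [finrank_euclideanSpace_fin] at h2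
  have h3 : Kᗮ ≠ ⊥ := by
    intro h
    rw [h, finrank_bot] at h2
    omega
  obtain ⟨w, hw, hw0⟩ := Submodule.exists_mem_ne_zero_of_ne_bot h3
  have hu : inner ℝ w u = 0 := Submodule.inner_left_of_mem_orthogonal
    (Submodule.subset_span (by simp)) hw
  have hv : inner ℝ w v = 0 := Submodule.inner_left_of_mem_orthogonal
    (Submodule.subset_span (by simp)) hw
  refine ⟨‖w‖⁻¹ • w, ?_, ?_, ?_⟩
  · simp [norm_smul, hw0]
  · rw [inner_smul_left, hu, mul_zero]
  · rw [inner_smul_left, hv, mul_zero]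

/-- The probability of the intersection of two hemispheres. -/
lemma capProb_zero (m : ℕ) (X Y : Hypersphere (m + 1)) :
    capProb (m + 1) X Y 0 = 1 / 2 - Real.arccos (inner ℝ (X : EuclideanSpace ℝ (Fin (m + 1 + 1)))
      (Y : EuclideanSpace ℝ (Fin (m + 1 + 1)))) / (2 * Real.pi) := by
  induction m with
  | zero =>
    rw [capProb_circle X Y rfl le_rfl, Real.arccos_zero]
    · field_simp
      ring
    · have := norm_add_eq_two_mul_cos X Y
      have := norm_nonneg (X + Y : EuclideanSpace ℝ (Fin (0 + 1 + 1)))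
      linarith
  | succ m ih =>
    -- Slice along an axis orthogonal to both `X` and `Y`: at level `0` the conditions are invariant
    -- under scaling by `√(1 - t²)`, so almost every slice has the probability from one dimension
    -- lower.
    obtain ⟨e, he, heX, heY⟩ := exists_unit_orthogonal
      (X : EuclideanSpace ℝ (Fin (m + 1 + 1 + 1))) (Y : EuclideanSpace ℝ (Fin (m + 1 + 1 + 1)))
    obtain ⟨L, hL, -⟩ := exists_isometry_map_eq (v := e)
      (w := cons 1 0) (by rw [norm_cons_one_zero, he])
    have key (W : Hypersphere (m + 1 + 1))
        (hW : inner ℝ e (W : EuclideanSpace ℝ (Fin (m + 1 + 1 + 1))) = 0) :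
        ∃ V : Hypersphere (m + 1), L W = cons 0 (V : EuclideanSpace ℝ (Fin (m + 1 + 1))) := by
      obtain ⟨c, y, hy⟩ := eq_cons (L W)
      have hc : c = 0 := by
        rw [← L.inner_map_map, hL, hy, inner_cons] at hW
        simpa using hW
      have h := norm_cons_sq c y
      have hWn : ‖(W : EuclideanSpace ℝ (Fin (m + 1 + 1 + 1)))‖ = 1 := by simp
      rw [← hy, L.norm_map, hWn, hc] at h
      have hyn : ‖y‖ = 1 :=
        (pow_eq_one_iff_of_nonneg (norm_nonneg _) two_ne_zero).1 (by linarith)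
      exact ⟨⟨y, by simpa using hyn⟩, by rw [hy, hc]⟩
    obtain ⟨X', hX'⟩ := key X heX
    obtain ⟨Y', hY'⟩ := key Y heY
    have hXY : inner ℝ (X : EuclideanSpace ℝ (Fin (m + 1 + 1 + 1)))
        (Y : EuclideanSpace ℝ (Fin (m + 1 + 1 + 1))) =
        inner ℝ (X' : EuclideanSpace ℝ (Fin (m + 1 + 1)))
          (Y' : EuclideanSpace ℝ (Fin (m + 1 + 1))) := by
      rw [← L.inner_map_map, hX', hY', inner_cons, mul_zero, zero_add]
    rw [hXY, ← ih X' Y', capProb_eq_real, capProb_eq_real, measureReal_def, measureReal_def]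
    congr 1
    have hS := measurableSet_inner_le_and (cons 0 (X' : EuclideanSpace ℝ (Fin (m + 1 + 1))))
      (cons 0 (Y' : EuclideanSpace ℝ (Fin (m + 1 + 1)))) 0 0
    have e1 := unifSphere_isometry (m + 1 + 1) L hS
    simp only [Set.mem_ofPred_eq, ← hX', ← hY', LinearIsometryEquiv.inner_map_map] at e1
    rw [hX', hY'] at e1
    refine e1.trans ((unifSphere_slice (m + 1) hS).trans ?_)
    trans ∫⁻ _, unifSphere (m + 1)
      ({γ | inner ℝ (γ : EuclideanSpace ℝ (Fin (m + 1 + 1))) X' ≤ 0} ∩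
        {γ | inner ℝ (γ : EuclideanSpace ℝ (Fin (m + 1 + 1))) Y' ≤ 0}) ∂(projMeasure (m + 1 + 1))
    · refine lintegral_congr_ae ?_
      filter_upwards [ae_projMeasure_mem_Ioo (m + 1 + 1)] with t ht
      have hw : 0 < √(1 - t ^ 2) := Real.sqrt_pos.2 (by nlinarith [ht.1, ht.2])
      congr 1
      ext ξ
      simp only [Set.mem_ofPred_eq, Set.mem_inter_iff, inner_cons, mul_zero, zero_add,
        inner_smul_left, conj_trivial]
      have hneg (a : ℝ) : √(1 - t ^ 2) * a ≤ 0 ↔ a ≤ 0 :=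
        ⟨fun h => nonpos_of_mul_nonpos_right h hw, mul_nonpos_of_nonneg_of_nonpos hw.le⟩
      rw [hneg, hneg]
    · rw [lintegral_const, measure_univ, mul_one]

end

/-! ### Assembling the formulas -/

theorem mainTheorem5 (q : ℕ) (hq : 1 ≤ q) (X Y : Hypersphere q) (θ x : ℝ)
    (hθ : θ = Real.arccos
      (inner ℝ (X : EuclideanSpace ℝ (Fin (q + 1))) (Y : EuclideanSpace ℝ (Fin (q + 1)))))
    (hx0 : 0 ≤ x) (hx1 : x ≤ 1) :
    capProb q X Y (-x) = capProb q X Y x + 1 - 2 * projCdf q x ∧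
    (q = 1 →
      capProb q X Y x = 2 * projCdf 1 x - 1 + 1 / Real.pi * max (Real.arccos x - θ / 2) 0) ∧
    (2 ≤ q →
      -- first expression, for `θ ∈ [0, π)`
      (θ < Real.pi →
        capProb q X Y x =
          2 * ∫ t in (-1 : ℝ)..x,
            projCdf (q - 1) (t * Real.tan (θ / 2) / Real.sqrt (1 - t ^ 2)) ∂(projMeasure q)) ∧
      -- first expression for `θ = π`, where `tan (π / 2) = +∞`, so that the value of `F_{q-1}` is
      -- `1` for `t > 0` and `0` for `t < 0`
      (θ = Real.pi →
        capProb q X Y x =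
          2 * ∫ t in (-1 : ℝ)..x,
            Set.indicator (Set.Ioi (0 : ℝ)) (fun _ => (1 : ℝ)) t ∂(projMeasure q)) ∧
      -- piecewise expression, where no argument of `F_{q-1}` leaves `[-1, 1]`
      (θ < 2 * Real.arccos x →
        capProb q X Y x =
          1 / 2 - θ / (2 * Real.pi) +
            2 * ∫ t in (0 : ℝ)..x,
              projCdf (q - 1) (t * Real.tan (θ / 2) / Real.sqrt (1 - t ^ 2)) ∂(projMeasure q) ∧
        ∀ t ∈ Set.Icc (0 : ℝ) x,
          t * Real.tan (θ / 2) / Real.sqrt (1 - t ^ 2) ∈ Set.Icc (-1 : ℝ) 1) ∧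
      (2 * Real.arccos x ≤ θ → capProb q X Y x = 2 * projCdf q x - 1)) := by
  obtain ⟨m, rfl⟩ : ∃ m, q = m + 1 := ⟨q - 1, by omega⟩
  have hθ0 : 0 ≤ θ := by rw [hθ]; exact Real.arccos_nonneg _
  have hθπ : θ ≤ Real.pi := by rw [hθ]; exact Real.arccos_le_pi _
  have hfar (h : 2 * Real.arccos x ≤ θ) :
      capProb (m + 1) X Y x = 2 * projCdf (m + 1) x - 1 := by
    refine capProb_of_disjoint m X Y ?_
    rw [norm_add_eq_two_mul_cos, ← hθ]
    have := Real.cos_le_cos_of_nonneg_of_le_pi (Real.arccos_nonneg x)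
      (by linarith [Real.pi_pos]) (show Real.arccos x ≤ θ / 2 by linarith)
    rw [Real.cos_arccos (by linarith) hx1] at this
    linarith
  have hnear (h : θ < 2 * Real.arccos x) : x < Real.cos (θ / 2) := by
    have := Real.cos_lt_cos_of_nonneg_of_le_pi (by linarith) (Real.arccos_le_pi x)
      (show θ / 2 < Real.arccos x by linarith)
    rwa [Real.cos_arccos (by linarith) hx1] at this
  have harc : 2 * Real.arccos x ≤ Real.pi := by
    linarith [Real.arccos_le_pi_div_two.2 hx0]
  refine ⟨capProb_neg m X Y x, fun hm => ?_, fun hm => ?_⟩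
  · obtain rfl : m = 0 := by omega
    rcases le_or_gt (2 * Real.arccos x) θ with h | h
    · rw [hfar h, max_eq_right (by linarith)]
      simp
    · rw [capProb_circle X Y hθ hx0 (hnear h).le, max_eq_left (by linarith),
        projCdf_one_eq (by linarith) hx1]
      field_simp
      ring
  · obtain ⟨k, rfl⟩ : ∃ k, m = k + 1 := ⟨m - 1, by omega⟩
    rw [Nat.add_sub_cancel]
    have hcond (h : θ < Real.pi) : ∃ g : ℝ → ℝ, Integrable g (projMeasure (k + 1 + 1)) ∧
        (g = fun t => projCdf (k + 1) (t * Real.tan (θ / 2) / √(1 - t ^ 2))) ∧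
        ∀ y, capProb (k + 1 + 1) X Y y = 2 * ∫ t in Set.Iic y, g t ∂(projMeasure (k + 1 + 1)) := by
      obtain ⟨Z, hZ⟩ := capProb_eq_integral_Iic (k + 1) X Y hθ h
      refine ⟨_, sphereCdf_comp_integrable Z
        (u := fun t => t * Real.tan (θ / 2) / √(1 - t ^ 2)) (by fun_prop) _, ?_, hZ⟩
      simp only [sphereCdf_eq_projCdf]
    refine ⟨fun h => ?_, fun h => ?_, fun h => ⟨?_, fun t ht => ?_⟩, hfar⟩
    · obtain ⟨g, -, rfl, hg⟩ := hcond h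
      rw [hg, projMeasure_setIntegral_Iic _ _ (by linarith)]
    -- As `x ≥ 0` gives `2 arccos x ≤ π`, the angle `θ = π` is in the disjoint regime, and the
    -- integral of the indicator is `F_q(x) - 1/2`.
    · rw [hfar (by linarith), ← projMeasure_setIntegral_Iic _ _ (by linarith),
        setIntegral_indicator measurableSet_Ioi, Set.inter_comm, Set.Ioi_inter_Iic,
        setIntegral_const, projMeasure_real_Ioc hq hx0, projCdf_zero, smul_eq_mul]
      ring
    · obtain ⟨g, hgi, rfl, hg⟩ := hcond (by linarith)
      -- The part of the integral below `0` is folded back into the value of `capProb` at level `0`.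
      rw [hg, setIntegral_Iic_eq_add hgi 0 x, mul_add, ← hg, capProb_zero, ← hθ]
    · have hmem := mul_tan_div_sqrt_mem_Ico ht.1 (by linarith : 0 ≤ θ / 2) (by linarith)
        (ht.2.trans_lt (hnear h))
      exact ⟨by linarith [hmem.1], hmem.2.le⟩
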